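/- Let $r\in\mathbf Q^*$ with $r\neq\pm1$. Let $R_\infty=\{x\in\overline{\mathbf Q}^*: x^k\in\langle r\rangle\text{ for some }k\in\mathbf Z_{>0}\}$ be the group of radicals of $r$, let $F_\infty=\mathbf Q(R_\infty)$ and $G=\mathrm{Gal}(F_\infty/\mathbf Q)$ with its Krull topology, and let $A=\mathrm{Aut}_{R_\infty\cap\mathbf Q^*}(R_\infty)$ be the group of group automorphisms of $R_\infty$ that are the identity on $R_\infty\cap\mathbf Q^*$, with the topology of pointwise convergence on the discrete set $R_\infty$. Let $\mathbf Q_{\rm ab}$ be the maximal abelian extension of $\mathbf Q$ in $\overline{\mathbf Q}$. There is $r_0\in\mathbf Q^*$ with $R_\infty\cap\mathbf Q^*=\langle r_0\rangle\times\langle-1\rangle$. For every such $r_0$, there is an embedding $\mathbf Q\to\overline{\mathbf Q}^*$, written $q\mapsto r_0^q$, that sends $1$ to $r_0$. For every such $r_0$ and every such embedding, with image $r_0^{\mathbf Q}$, the following hold. 1. $r_0^{\mathbf Q}\cap\mathbf Q_{\rm ab}^*=r_0^{\frac12\mathbf Z}$. 2. Let $\widehat\mu=\varprojlim_n\mu_n(\overline{\mathbf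 Q})$ (with transition maps $\mu_{mn}\to\mu_n$, $x\mapsto x^m$), on which $\widehat{\mathbf Z}^*$ acts by exponentiation, and give $\widehat\mu\rtimes\widehat{\mathbf Z}^*$ the product of the profinite topologies. There is an isomorphism of topological groups $\Phi:\widehat\mu\rtimes\widehat{\mathbf Z}^*\to A$ such that $\Phi(x,u)$ sends $r_0^{1/n}$ to $x_n\,r_0^{1/n}$ and $\zeta\in\mu_n(\overline{\mathbf Q})$ to $\zeta^{u}=\zeta^{u\bmod n}$, for all $n\ge1$. 3. Let $K=\mathbf Q(\sqrt{r_0})=\mathbf Q(r_0^{1/2})$ and let $d$ be its discriminant. There are characters (group homomorphisms) $\psi_K,\chi_K:A\to\{\pm1\}$ with $$\psi_K(\Phi(x,u))=x_2,\quad\text{equivalently}\quad a(r_0^{1/2})=\psi_K(a)\,r_0^{1/2}\ \ (a\in A),$$ and $$\chi_K(\Phi(x,u))=\Bigl(\frac{d}{\,u\bmod |d|\,}\Bigr),$$ where $u\bmod|d|$ is represented by an integer in $\{1,\dots,|d|\}$ and $\bigl(\frac d\cdot\bigr)$ is the Kronecker symbol. The natural map $G\to A$ that sends a field automorphism of $F_\infty$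 to its restriction to $R_\infty$ is an injective homomorphism and a homeomorphism onto an open subgroup of $A$; this image is the kernel of $\psi_K\cdot\chi_K:A\to\{\pm1\}$, and it has index $2$ in $A$. -/

import Mathlib

noncomputable section

namespace RadicalGalois

/-- The algebraic closure of `ℚ` in which all radicals are taken. -/
abbrev Qbar : Type := AlgebraicClosure ℚ

/-- Among the (equal) `ℚ`-algebra structures on the algebraic closure, instance search picks
the one for which Mathlib proves that it is an algebraic closure. -/
instance : Algebra ℚ Qbar := AlgebraicClosure.instAlgebra ℚ

/-- Among the (equal) `ℚ`-algebra structures on a subfield of the algebraic closure, instance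
search picks the one of intermediate fields. -/
instance (F : IntermediateField ℚ Qbar) : Algebra ℚ F := IntermediateField.algebra' F

/-- The inclusion of `ℚ*` in the multiplicative group of the algebraic closure. -/
def ratUnits : ℚˣ →* Qbarˣ := Units.map (algebraMap ℚ Qbar).toMonoidHom

/-- The group `R_∞` of radicals of `r`: all `x` with `x ^ k ∈ ⟨r⟩` for some `k > 0`. -/
def radicals (r : ℚˣ) : Subgroup Qbarˣ where
  carrier := {x | ∃ k : ℕ, 0 < k ∧ x ^ k ∈ Subgroup.zpowers (ratUnits r)}
  one_mem' := ⟨1, one_pos, by simp⟩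
  mul_mem' := by
    rintro x y ⟨k, hk, hx⟩ ⟨l, hl, hy⟩
    refine ⟨k * l, Nat.mul_pos hk hl, ?_⟩
    rw [mul_pow, pow_mul, mul_comm k l, pow_mul]
    exact mul_mem (pow_mem hx _) (pow_mem hy _)
  inv_mem' := by
    rintro x ⟨k, hk, hx⟩
    exact ⟨k, hk, by rw [inv_pow]; exact inv_mem hx⟩

/-- The group `R_∞ ∩ ℚ*`, as a subgroup of `ℚ*`. -/
def ratRadicals (r : ℚˣ) : Subgroup ℚˣ := (radicals r).comap ratUnits

/-- `R_∞ ∩ ℚ* = ⟨r₀⟩ × ⟨-1⟩` (internal direct product). -/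
def IsRadicalGenerator (r r₀ : ℚˣ) : Prop :=
  Subgroup.zpowers r₀ ⊔ Subgroup.zpowers (-1) = ratRadicals r ∧
    Disjoint (Subgroup.zpowers r₀) (Subgroup.zpowers (-1 : ℚˣ))

/-- The field `F_∞ = ℚ(R_∞)`. -/
def radicalField (r : ℚˣ) : IntermediateField ℚ Qbar :=
  IntermediateField.adjoin ℚ ((fun x : Qbarˣ => (x : Qbar)) '' (radicals r : Set Qbarˣ))

/-- The group `A` of group automorphisms of `R_∞` that are the identity on `R_∞ ∩ ℚ*`. -/
def radicalAut (r : ℚˣ) : Subgroup (MulAut (radicals r)) where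
  carrier := {a | ∀ x : radicals r, (x : Qbarˣ) ∈ ratUnits.range → a x = x}
  one_mem' := fun _ _ => rfl
  mul_mem' := by
    intro a b ha hb x hx
    rw [MulAut.mul_apply, hb x hx, ha x hx]
  inv_mem' := by
    intro a ha x hx
    rw [MulAut.inv_apply, MulEquiv.symm_apply_eq, ha x hx]

/-- The Krull topology on `A`: the topology of pointwise convergence on the discrete
set `R_∞`, whose basic neighbourhoods of `1` are the pointwise stabilizers of finite subsets. -/
instance (r : ℚˣ) : TopologicalSpace (radicalAut r) :=
  TopologicalSpace.induced
    (fun (a : radicalAut r) (x : radicals r) => (a : MulAut (radicals r)) x)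
    (@Pi.topologicalSpace (radicals r) (fun _ => radicals r) (fun _ => ⊥))

/-- A radical of `r`, viewed as a unit of the field `F_∞`. -/
def toField (r : ℚˣ) : radicals r →* (radicalField r)ˣ where
  toFun x := Units.mk0
    ⟨((x : Qbarˣ) : Qbar), IntermediateField.subset_adjoin ℚ _ ⟨(x : Qbarˣ), x.2, rfl⟩⟩
    (fun h => (x : Qbarˣ).ne_zero (congrArg Subtype.val h))
  map_one' := by ext; rfl
  map_mul' x y := by ext; rfl

/-- The inclusion of the unit group of `F_∞` in that of the algebraic closure. -/
def fieldUnits (r : ℚˣ) : (radicalField r)ˣ →* Qbarˣ :=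
  Units.map (radicalField r).val.toRingHom.toMonoidHom

lemma fieldUnits_toField (r : ℚˣ) (x : radicals r) : fieldUnits r (toField r x) = x := by
  ext; rfl

/-- A field automorphism of `F_∞`, acting on a radical. -/
def galAct (r : ℚˣ) (g : Gal(radicalField r/ℚ)) (x : radicals r) : Qbarˣ :=
  fieldUnits r (Units.map (g : radicalField r →* radicalField r) (toField r x))

lemma galAct_val (r : ℚˣ) (g : Gal(radicalField r/ℚ)) (x : radicals r) :
    ((galAct r g x : Qbarˣ) : Qbar) = (g (toField r x : radicalField r) : Qbar) := rfl

lemma galAct_of_rat (r : ℚˣ) (g : Gal(radicalField r/ℚ)) (x : radicals r)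
    (hx : (x : Qbarˣ) ∈ ratUnits.range) : galAct r g x = x := by
  obtain ⟨q, hq⟩ := hx
  have h : (toField r x : radicalField r) = algebraMap ℚ (radicalField r) (q : ℚ) := by
    apply Subtype.ext
    exact (congrArg Units.val hq).symm
  apply Units.ext
  rw [galAct_val, h, AlgEquiv.commutes, ← h]
  rfl

lemma galAct_mul (r : ℚˣ) (g : Gal(radicalField r/ℚ)) (x y : radicals r) :
    galAct r g (x * y) = galAct r g x * galAct r g y := by
  simp only [galAct, map_mul]

/-- The action of `g` as a homomorphism on radicals. -/
def galHom (r : ℚˣ) (g : Gal(radicalField r/ℚ)) : radicals r →* Qbarˣ :=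
  MonoidHom.mk' (galAct r g) (galAct_mul r g)

lemma galAct_mem (r : ℚˣ) (g : Gal(radicalField r/ℚ)) (x : radicals r) :
    galAct r g x ∈ radicals r := by
  obtain ⟨k, hk, j, hj⟩ := x.2
  refine ⟨k, hk, j, ?_⟩
  have hrat : ((x ^ k : radicals r) : Qbarˣ) ∈ ratUnits.range :=
    ⟨r ^ j, by rw [map_zpow]; exact hj⟩
  have h1 : galHom r g (x ^ k) = ((x ^ k : radicals r) : Qbarˣ) := galAct_of_rat r g _ hrat
  rw [map_pow] at h1
  exact hj.trans h1.symm

lemma galAct_comp (r : ℚˣ) (g h : Gal(radicalField r/ℚ)) (x : radicals r) :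
    galAct r g ⟨galAct r h x, galAct_mem r h x⟩ = galAct r (g * h) x := by
  have h1 : (toField r ⟨galAct r h x, galAct_mem r h x⟩ : radicalField r)
      = h (toField r x : radicalField r) := Subtype.ext rfl
  apply Units.ext
  rw [galAct_val, galAct_val, h1, AlgEquiv.mul_apply]

lemma galAct_one (r : ℚˣ) (x : radicals r) : galAct r 1 x = x := by
  apply Units.ext
  rw [galAct_val, AlgEquiv.one_apply]
  rfl

/-- The action of `g` as a group automorphism of `R_∞`. -/
def galAut (r : ℚˣ) (g : Gal(radicalField r/ℚ)) : MulAut (radicals r) where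
  toFun x := ⟨galAct r g x, galAct_mem r g x⟩
  invFun x := ⟨galAct r g⁻¹ x, galAct_mem r g⁻¹ x⟩
  left_inv x := by
    apply Subtype.ext
    change galAct r g⁻¹ ⟨galAct r g x, galAct_mem r g x⟩ = x
    rw [galAct_comp, inv_mul_cancel, galAct_one]
  right_inv x := by
    apply Subtype.ext
    change galAct r g ⟨galAct r g⁻¹ x, galAct_mem r g⁻¹ x⟩ = x
    rw [galAct_comp, mul_inv_cancel, galAct_one]
  map_mul' x y := Subtype.ext (galAct_mul r g x y)

/-- The natural map `G = Gal(F_∞/ℚ) → A`, sending a field automorphism of `F_∞` to its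
restriction to the group of radicals. -/
def galoisRep (r : ℚˣ) : Gal(radicalField r/ℚ) →* radicalAut r where
  toFun g := ⟨galAut r g, fun x hx => Subtype.ext (galAct_of_rat r g x hx)⟩
  map_one' := by
    apply Subtype.ext; ext1 x
    exact Subtype.ext (galAct_one r x)
  map_mul' g h := by
    apply Subtype.ext; ext1 x
    exact Subtype.ext (galAct_comp r g h x).symm

/-- The maximal abelian extension `ℚ_ab` of `ℚ`, the compositum of all abelian extensions. -/
def Qab : IntermediateField ℚ Qbar :=
  ⨆ E : {E : IntermediateField ℚ Qbar // IsAbelianGalois ℚ E}, E.1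

/-- The multiplicative group of `ℚ_ab`. -/
def QabUnits : Subgroup Qbarˣ where
  carrier := {x | (x : Qbar) ∈ Qab}
  one_mem' := Qab.one_mem
  mul_mem' := fun hx hy => Qab.mul_mem hx hy
  inv_mem' := by
    intro x hx
    change ((x⁻¹ : Qbarˣ) : Qbar) ∈ Qab
    rw [Units.val_inv_eq_inv_val]
    exact Qab.inv_mem hx

/-- `ρ` is an embedding `q ↦ r₀ ^ q` of `ℚ` in the multiplicative group of the algebraic
closure that sends `1` to `r₀`. -/
def IsRationalPower (r₀ : ℚˣ) (ρ : Multiplicative ℚ →* Qbarˣ) : Prop :=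
  Function.Injective ρ ∧ ρ (Multiplicative.ofAdd 1) = ratUnits r₀

/-- `rpow ρ q` is `r₀ ^ q`. -/
def rpow (ρ : Multiplicative ℚ →* Qbarˣ) (q : ℚ) : Qbarˣ := ρ (Multiplicative.ofAdd q)

/-- The field `K = ℚ(√r₀)`, generated by `r₀ ^ (1/2)`. -/
def quadField (ρ : Multiplicative ℚ →* Qbarˣ) : IntermediateField ℚ Qbar :=
  IntermediateField.adjoin ℚ {(rpow ρ (1 / 2) : Qbar)}

instance (ρ : Multiplicative ℚ →* Qbarˣ) : NumberField (quadField ρ) where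
  to_charZero := inferInstance
  to_finiteDimensional := by
    rw [Subsingleton.elim (DivisionRing.toRatAlgebra : Algebra ℚ (quadField ρ))
      (IntermediateField.algebra' _)]
    exact IntermediateField.adjoin.finiteDimensional
      (Algebra.IsAlgebraic.isAlgebraic (rpow ρ (1 / 2) : Qbar)).isIntegral

/-- The absolute value of the discriminant of `K`, as a positive integer. -/
def absDiscr (ρ : Multiplicative ℚ →* Qbarˣ) : ℕ+ :=
  ⟨(NumberField.discr (quadField ρ)).natAbs, Int.natAbs_pos.2 (NumberField.discr_ne_zero _)⟩

/-- The Kronecker symbol `(d / n)` for `n > 0`: the completely multiplicative extension in `n`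
of the Legendre symbol `(d / p)` at odd primes `p`, with `(d / 2)` equal to `0` for `d` even,
`1` for `d ≡ ±1 mod 8` and `-1` for `d ≡ ±3 mod 8`. -/
def kroneckerSymbol (d : ℤ) (n : ℕ) : ℤ :=
  (n.primeFactorsList.map fun p => if p = 2 then ZMod.χ₈ (d : ZMod 8) else jacobiSym d p).prod

/-- The ring `Ẑ`, the inverse limit of the rings `ℤ/nℤ`, with its profinite topology. -/
def ZHat : Subring (∀ n : ℕ+, ZMod n) where
  carrier := {x | ∀ (m n : ℕ+) (h : (m : ℕ) ∣ n), ZMod.castHom h (ZMod m) (x n) = x m}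
  one_mem' := fun _ _ _ => map_one _
  zero_mem' := fun _ _ _ => map_zero _
  mul_mem' := by
    intro x y hx hy m n h
    rw [Pi.mul_apply, map_mul, hx m n h, hy m n h, Pi.mul_apply]
  add_mem' := by
    intro x y hx hy m n h
    rw [Pi.add_apply, map_add, hx m n h, hy m n h, Pi.add_apply]
  neg_mem' := by
    intro x hx m n h
    rw [Pi.neg_apply, map_neg, hx m n h, Pi.neg_apply]

/-- The representative in `{0, …, n - 1}` of the class modulo `n` of a unit of `Ẑ`. -/
def residue (u : ZHatˣ) (n : ℕ+) : ℕ := ((u : ZHat) : ∀ n : ℕ+, ZMod n) n |>.val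

/-- The Tate module `μ̂`, the inverse limit of the groups `μ_n` with respect to the
maps `μ_{mn} → μ_n`, `x ↦ x ^ m`. -/
def TateModule : Subgroup (∀ n : ℕ+, rootsOfUnity n Qbar) where
  carrier := {x | ∀ m n : ℕ+, ((x (m * n) : Qbarˣ)) ^ (m : ℕ) = (x n : Qbarˣ)}
  one_mem' := by intro m n; simp
  mul_mem' := by
    intro x y hx hy m n
    simp only [Pi.mul_apply, Subgroup.coe_mul, mul_pow, hx m n, hy m n]
  inv_mem' := by
    intro x hx m n
    simp only [Pi.inv_apply, Subgroup.coe_inv, inv_pow, hx m n]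

/-- The `n`-th component, in `μ_n`, of an element of the Tate module. -/
def component (x : TateModule) (n : ℕ+) : Qbarˣ :=
  ((x : ∀ n : ℕ+, rootsOfUnity n Qbar) n : Qbarˣ)

/-- The profinite topology on `μ̂`, induced by the discrete topologies on the groups `μ_n`. -/
instance : TopologicalSpace TateModule :=
  TopologicalSpace.induced (fun x : TateModule => (x : ∀ n : ℕ+, rootsOfUnity n Qbar))
    (@Pi.topologicalSpace ℕ+ (fun n => rootsOfUnity n Qbar) (fun _ => ⊥))

lemma component_pow (x : TateModule) (n : ℕ+) : component x n ^ (n : ℕ) = 1 :=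
  (mem_rootsOfUnity _ _).1 ((x : ∀ n : ℕ+, rootsOfUnity n Qbar) n).2

lemma pow_eq_of_cast {n : ℕ+} {z : Qbarˣ} (hz : z ^ (n : ℕ) = 1) {a b : ℕ}
    (h : (a : ZMod n) = b) : z ^ a = z ^ b := by
  have h' := (ZMod.natCast_eq_natCast_iff a b n).1 h
  exact pow_eq_pow_iff_modEq.2 (h'.of_dvd (orderOf_dvd_of_pow_eq_one hz))

lemma residue_cast (u : ZHatˣ) (n : ℕ+) :
    ((residue u n : ℕ) : ZMod n) = ((u : ZHat) : ∀ n : ℕ+, ZMod n) n :=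
  ZMod.natCast_zmod_val _

lemma residue_cast_of_dvd (u : ZHatˣ) {m n : ℕ+} (h : (m : ℕ) ∣ n) :
    ((residue u n : ℕ) : ZMod m) = (residue u m : ℕ) := by
  rw [residue_cast u m, ← (u : ZHat).2 m n h, ← residue_cast u n, map_natCast]

lemma residue_mul (u v : ZHatˣ) (n : ℕ+) :
    ((residue (u * v) n : ℕ) : ZMod n) = ((residue u n * residue v n : ℕ) : ZMod n) := by
  rw [Nat.cast_mul, residue_cast, residue_cast, residue_cast]
  rfl

lemma residue_one (n : ℕ+) : ((residue 1 n : ℕ) : ZMod n) = ((1 : ℕ) : ZMod n) := by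
  rw [residue_cast, Nat.cast_one]
  rfl

/-- Exponentiation by a unit `u` of `Ẑ` on the Tate module. -/
def tatePow (u : ZHatˣ) : TateModule →* TateModule where
  toFun x := ⟨fun n => (x : ∀ n : ℕ+, rootsOfUnity n Qbar) n ^ residue u n, by
    intro m n
    have hx : component x (m * n) ^ (m : ℕ) = component x n := x.2 m n
    change (component x (m * n) ^ residue u (m * n)) ^ (m : ℕ) = component x n ^ residue u n
    rw [← pow_mul, mul_comm (residue u (m * n)), pow_mul, hx]
    exact pow_eq_of_cast (component_pow x n)
      (residue_cast_of_dvd u (by rw [PNat.mul_coe]; exact Dvd.intro_left _ rfl))⟩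
  map_one' := by
    apply Subtype.ext; funext n
    exact one_pow _
  map_mul' x y := by
    apply Subtype.ext; funext n
    exact mul_pow _ _ _

lemma component_tatePow (u : ZHatˣ) (x : TateModule) (n : ℕ+) :
    component (tatePow u x) n = component x n ^ residue u n := rfl

lemma tate_ext {x y : TateModule} (h : ∀ n, component x n = component y n) : x = y := by
  apply Subtype.ext; funext n
  exact Subtype.ext (h n)

lemma tatePow_one (x : TateModule) : tatePow 1 x = x := by
  apply tate_ext; intro n
  rw [component_tatePow, pow_eq_of_cast (component_pow x n) (residue_one n), pow_one]

lemma tatePow_mul (u v : ZHatˣ) (x : TateModule) :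
    tatePow (u * v) x = tatePow u (tatePow v x) := by
  apply tate_ext; intro n
  rw [component_tatePow, component_tatePow, component_tatePow, ← pow_mul,
    mul_comm (residue v n)]
  exact pow_eq_of_cast (component_pow x n) (residue_mul u v n)

/-- The action of `Ẑ*` on the `Ẑ`-module `μ̂` by multiplication (written as exponentiation). -/
def tateAction : ZHatˣ →* MulAut TateModule where
  toFun u :=
    { toFun := tatePow u
      invFun := tatePow u⁻¹
      left_inv := fun x => by rw [← tatePow_mul, inv_mul_cancel, tatePow_one]
      right_inv := fun x => by rw [← tatePow_mul, mul_inv_cancel, tatePow_one]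
      map_mul' := map_mul _ }
  map_one' := by ext1 x; exact tatePow_one x
  map_mul' u v := by ext1 x; exact tatePow_mul u v x

/-- The affine group `μ̂ ⋊ Ẑ*`. -/
abbrev AffineGroup : Type := TateModule ⋊[tateAction] ZHatˣ

/-- The product topology on `μ̂ ⋊ Ẑ*`. -/
instance : TopologicalSpace AffineGroup :=
  TopologicalSpace.induced (fun a : AffineGroup => (a.left, a.right)) inferInstance

end RadicalGalois

end

/-!
The proof rests on the decomposition `R_∞ = μ_∞ × r₀ ^ ℚ` (`IsRationalPower.exists_torsion`). An
automorphism in `A` is determined by its action on the roots of unity, which is exponentiation by a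
unit `u` of `Ẑ`, and by the compatible system `x_n = a (r₀ ^ (1/n)) / r₀ ^ (1/n)`; conversely all
pairs `(x, u)` occur, which gives the isomorphism `affHomeo` with the affine group.

The abelian part is a commutator computation (`IsRationalPower.exists_eq_half`): if the Galois group
acts on the conjugates of `x = r₀ ^ a` through an abelian quotient, take `τ` inverting the roots of
unity of order dividing the denominator of `a`. With `τ x = t x`, the number `t x ^ 2` is then fixed
by every `σ`, hence rational, and as `r₀` generates `R_∞ ∩ ℚ*` up to sign, `2 a` is an integer.

That the image of Galois lies in the kernel of `ψ_K χ_K` means that an automorphism acting on the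
roots of unity through `u` multiplies `√d` by the Kronecker symbol `(d / u)`. This is proved for
the square root of any non-zero integer, with the Jacobi symbol in place of the Kronecker symbol
(`sqrtReciprocity`): the claim is multiplicative in the integer, and for primes it follows from
Gauss sums and quadratic reciprocity. Two properties of the discriminant `d` of `K` are needed: it
is `r₀` up to a rational square (`discr_eq_sq_mul`), and it is `0` or `1` modulo `4`
(`discr_emod_four`), which makes `(d / u)` periodic modulo `|d|` (`kroneckerSymbol_mod`).

Conversely, let `a` in `A` satisfy `ψ_K(a) = χ_K(a)`, and let `M = 2 L` be a multiple of `4 d`.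
Some automorphism `σ₀` acts like `a` on the `M`-th roots of unity, by irreducibility of the
cyclotomic polynomial, and then also on `√r₀`. So `a` and `σ₀` differ at `r₀ ^ (1/M)` by an `L`-th
root of unity, and all of these come from automorphisms fixing the `M`-th roots of unity
(`mem_kummerGroup`), since otherwise a power `r₀ ^ (k/M)` with `2 k / M` not an integer would have
abelian conjugates. Compactness of the Galois group passes from the levels `M` to the limit.
-/

noncomputable section

namespace RadicalGalois

/-! ### Reciprocity and the Kronecker symbol -/

/-- Quadratic reciprocity for a possibly negative integer `a ≡ 1 mod 4`. -/
lemma jacobiSym_eq_of_emod_four_eq_one {a : ℤ} (ha : a % 4 = 1) {n : ℕ} (hn : Odd n) :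
    jacobiSym a n = jacobiSym n a.natAbs := by
  rcases Int.natAbs_eq a with h | h
  · have h4 : a.natAbs % 4 = 1 := by omega
    conv_lhs => rw [h]
    exact jacobiSym.quadratic_reciprocity_one_mod_four h4 hn
  · have h4 : a.natAbs % 4 = 3 := by omega
    conv_lhs => rw [h]
    have ho : Odd a.natAbs := by rw [Nat.odd_iff]; omega
    rw [jacobiSym.neg _ hn]
    rcases Nat.odd_mod_four_iff.1 (Nat.odd_iff.1 hn) with h1 | h3
    · rw [ZMod.χ₄_nat_one_mod_four h1, one_mul,
        jacobiSym.quadratic_reciprocity_one_mod_four' ho h1]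
    · rw [ZMod.χ₄_nat_three_mod_four h3, jacobiSym.quadratic_reciprocity_three_mod_four h4 h3]
      ring

lemma kroneckerSymbol_of_odd (d : ℤ) {n : ℕ} (hn : Odd n) :
    kroneckerSymbol d n = jacobiSym d n := by
  have h0 : n ≠ 0 := by rintro rfl; simp at hn
  conv_rhs => rw [← Nat.prod_primeFactorsList h0]
  rw [jacobiSym.list_prod_right fun p hp => (Nat.prime_of_mem_primeFactorsList hp).ne_zero,
    kroneckerSymbol]
  congr 1
  refine List.map_congr_left fun p hp => if_neg ?_
  rintro rfl
  exact (Nat.not_even_iff_odd.2 hn) (even_iff_two_dvd.2 (Nat.dvd_of_mem_primeFactorsList hp))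

lemma kroneckerSymbol_of_emod_four_eq_one {d : ℤ} (hd : d % 4 = 1) {n : ℕ} (hn : n ≠ 0) :
    kroneckerSymbol d n = jacobiSym n d.natAbs := by
  conv_rhs => rw [← Nat.prod_primeFactorsList hn]
  rw [Nat.cast_list_prod, jacobiSym.list_prod_left, kroneckerSymbol, List.map_map]
  congr 1
  refine List.map_congr_left fun p hp => ?_
  have hp' := Nat.prime_of_mem_primeFactorsList hp
  rw [Function.comp_apply]
  split_ifs with h2
  · subst h2
    have ho : Odd d.natAbs := by rw [Nat.odd_iff]; omega
    rw [Nat.cast_ofNat, jacobiSym.at_two ho, ZMod.χ₈_int_eq_if_mod_eight,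
      ZMod.χ₈_nat_eq_if_mod_eight]
    have h1 : ¬ d % 2 = 0 := by omega
    have h2 : ¬ d.natAbs % 2 = 0 := by omega
    rw [if_neg h1, if_neg h2]
    congr 1
    apply propext
    omega
  · exact jacobiSym_eq_of_emod_four_eq_one hd (hp'.odd_of_ne_two h2)

/-- For `d ≡ 0, 1 mod 4`, the Kronecker symbol at the residue modulo `|d|` of an odd number `v` is
the Jacobi symbol at `v`. The last hypothesis excludes the residue `0`, at which the list of prime
factors is empty and the Kronecker symbol takes the value `1`; for `|d| = 1` this value is right. -/
lemma kroneckerSymbol_mod {d : ℤ} (hd : d % 4 = 0 ∨ d % 4 = 1) {v : ℕ}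
    (hv : Odd v) (hcop : d.natAbs = 1 ∨ v % d.natAbs ≠ 0) :
    kroneckerSymbol d (v % d.natAbs) = jacobiSym d v := by
  rcases hd with hd | hd
  · have hodd : Odd (v % d.natAbs) := hv.mod_even (by rw [even_iff_two_dvd]; omega)
    rw [kroneckerSymbol_of_odd d hodd, ← jacobiSym.div_four_left hd (Nat.odd_iff.1 hodd),
      ← jacobiSym.div_four_left hd (Nat.odd_iff.1 hv), jacobiSym.mod_right _ hv]
    congr 1
    congr 1
    omega
  · rw [jacobiSym_eq_of_emod_four_eq_one hd hv, jacobiSym.mod_left (v : ℤ)]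
    rcases hcop with h | h
    · rw [h, Nat.mod_one]
      simp [kroneckerSymbol]
    · rw [kroneckerSymbol_of_emod_four_eq_one hd h]
      push_cast
      rfl

/-! ### Galois action on square roots of integers -/

/-- The automorphism `σ` raises every `k`-th root of unity to the power `n`. -/
def ActsOnRoots (σ : Qbar ≃ₐ[ℚ] Qbar) (k n : ℕ) : Prop :=
  ∀ z : Qbar, z ^ k = 1 → σ z = z ^ n

lemma ActsOnRoots.of_dvd {σ : Qbar ≃ₐ[ℚ] Qbar} {k l n : ℕ} (h : ActsOnRoots σ k n)
    (hl : l ∣ k) : ActsOnRoots σ l n := by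
  intro z hz
  obtain ⟨m, rfl⟩ := hl
  exact h z (by rw [pow_mul, hz, one_pow])

lemma exists_primitive (n : ℕ) (hn : n ≠ 0) : ∃ z : Qbar, IsPrimitiveRoot z n := by
  have : NeZero (n : Qbar) := ⟨by exact_mod_cast hn⟩
  exact HasEnoughRootsOfUnity.exists_primitiveRoot Qbar n

/-- Cyclotomic reciprocity for square roots of `a`: an automorphism acting on the `4|a|`-th roots
of unity through the odd number `n` acts on the square roots of `a` through the Jacobi symbol
`(a / n)`. -/
def SqrtReciprocity (a : ℤ) : Prop :=
  ∀ (σ : Qbar ≃ₐ[ℚ] Qbar) (n : ℕ), Odd n → ActsOnRoots σ (4 * a.natAbs) n →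
    ∀ s : Qbar, s ^ 2 = a → σ s = jacobiSym a n * s

/-- It suffices to know the action on one square root. -/
lemma sqrtReciprocity_of_exists {a : ℤ} (h : ∃ s : Qbar, s ^ 2 = a ∧
    ∀ (σ : Qbar ≃ₐ[ℚ] Qbar) (n : ℕ), Odd n → ActsOnRoots σ (4 * a.natAbs) n →
      σ s = jacobiSym a n * s) : SqrtReciprocity a := by
  obtain ⟨s, hs, h⟩ := h
  intro σ n hn hσ t ht
  rcases sq_eq_sq_iff_eq_or_eq_neg.1 (ht.trans hs.symm) with rfl | rfl
  · exact h σ n hn hσ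
  · rw [map_neg, h σ n hn hσ, mul_neg]

lemma SqrtReciprocity.mul {a b : ℤ} (ha : SqrtReciprocity a) (hb : SqrtReciprocity b) :
    SqrtReciprocity (a * b) := by
  obtain ⟨s, hs⟩ := IsAlgClosed.exists_pow_nat_eq (a : Qbar) two_pos
  obtain ⟨t, ht⟩ := IsAlgClosed.exists_pow_nat_eq (b : Qbar) two_pos
  refine sqrtReciprocity_of_exists ⟨s * t, by rw [mul_pow, hs, ht]; push_cast; ring, ?_⟩
  intro σ n hn hσ
  rw [map_mul, ha σ n hn (hσ.of_dvd (by rw [Int.natAbs_mul, ← mul_assoc]; exact dvd_mul_right _ _))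
    s hs, hb σ n hn (hσ.of_dvd (by
      rw [Int.natAbs_mul, mul_left_comm]; exact dvd_mul_left _ _)) t ht, jacobiSym.mul_left]
  push_cast
  ring

lemma sqrtReciprocity_one : SqrtReciprocity 1 :=
  sqrtReciprocity_of_exists ⟨1, by simp, by simp⟩

lemma sqrtReciprocity_neg_one : SqrtReciprocity (-1) := by
  intro σ n hn hσ s hs
  have hs' : s ^ 2 = -1 := by simpa using hs
  have h4 : s ^ 4 = 1 := by linear_combination (s ^ 2 - 1) * hs'
  rw [hσ s (by simpa using h4), jacobiSym.at_neg_one hn, pow_eq_pow_mod n h4]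
  rcases Nat.odd_mod_four_iff.1 (Nat.odd_iff.1 hn) with h1 | h3
  · rw [ZMod.χ₄_nat_one_mod_four h1, h1]; simp
  · rw [ZMod.χ₄_nat_three_mod_four h3, h3]; push_cast
    linear_combination s * hs'

lemma sqrtReciprocity_two : SqrtReciprocity 2 := by
  obtain ⟨z, hz⟩ := exists_primitive 8 (by norm_num)
  have h8 : z ^ 8 = 1 := hz.pow_eq_one
  have h4 : z ^ 4 = -1 := by
    have : (z ^ 4) ^ 2 = 1 := by rw [← pow_mul]; exact h8
    rcases sq_eq_sq_iff_eq_or_eq_neg.1 (this.trans (one_pow 2).symm) with h | h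
    · exact absurd h (hz.pow_ne_one_of_pos_of_lt (by norm_num) (by norm_num))
    · exact h
  refine sqrtReciprocity_of_exists ⟨z + z ^ 7, ?_, ?_⟩
  · push_cast
    linear_combination z ^ 2 * (z ^ 8 - z ^ 4 + 1) * h4 + 2 * h8
  intro σ n hn hσ
  rw [map_add, map_pow, hσ z (by simpa using h8), jacobiSym.at_two hn, ZMod.χ₈_nat_eq_if_mod_eight,
    ← pow_mul, pow_eq_pow_mod n h8, pow_eq_pow_mod (n * 7) h8]
  have hn' := Nat.odd_iff.1 hn
  have : n % 8 = 1 ∨ n % 8 = 3 ∨ n % 8 = 5 ∨ n % 8 = 7 := by omega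
  rw [if_neg (by omega)]
  rcases this with h | h | h | h
  · have h' : n * 7 % 8 = 7 := by omega
    rw [h, h']; simp
  · have h' : n * 7 % 8 = 5 := by omega
    rw [h, h']; simp
    linear_combination (z ^ 3 + z) * h4
  · have h' : n * 7 % 8 = 3 := by omega
    rw [h, h']; simp
    linear_combination (z ^ 3 + z) * h4
  · have h' : n * 7 % 8 = 1 := by omega
    rw [h, h']; simp; ring

/-- The quadratic Gauss sum of an odd prime `q` is a square root of `q* = ±q ≡ 1 mod 4`, on which
`σ` acts through the quadratic character; reciprocity converts this into `(q* / n)`. -/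
lemma sqrtReciprocity_prime_star (q : ℕ) [Fact q.Prime] (hq : q ≠ 2) :
    SqrtReciprocity (ZMod.χ₄ q * q) := by
  obtain ⟨z, hz⟩ := exists_primitive q (Nat.Prime.ne_zero Fact.out)
  set χ : MulChar (ZMod q) Qbar := (quadraticChar (ZMod q)).ringHomComp (Int.castRingHom Qbar)
    with hχ
  have hodd : Odd q := (Fact.out : q.Prime).odd_of_ne_two hq
  have hchar : ringChar (ZMod q) ≠ 2 := by rwa [ZMod.ringChar_zmod_n]
  have hχ1 : χ ≠ 1 := by
    intro h
    obtain ⟨a, ha⟩ := quadraticChar_exists_neg_one' hchar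
    have := DFunLike.congr_fun h (a : ZMod q)
    rw [hχ, MulChar.ringHomComp_apply, ha, MulChar.one_apply_coe] at this
    norm_num at this
  have hχ2 : χ.IsQuadratic := (quadraticChar_isQuadratic (ZMod q)).comp _
  have hq1 : z ^ q = 1 := hz.pow_eq_one
  set ψ := AddChar.zmodChar q hq1 with hψ
  have hprim : ψ.IsPrimitive := AddChar.zmodChar_primitive_of_primitive_root q hz
  have hχ4 : ZMod.χ₄ q = quadraticChar (ZMod q) (-1) := by
    rw [quadraticChar_neg_one hchar, ZMod.card]
  have hstar : (ZMod.χ₄ q * q : ℤ) % 4 = 1 ∧ (ZMod.χ₄ q * q : ℤ).natAbs = q := by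
    rcases Nat.odd_mod_four_iff.1 (Nat.odd_iff.1 hodd) with h1 | h3
    · rw [ZMod.χ₄_nat_one_mod_four h1]; omega
    · rw [ZMod.χ₄_nat_three_mod_four h3]; omega
  refine sqrtReciprocity_of_exists ⟨gaussSum χ ψ, ?_, ?_⟩
  · rw [gaussSum_sq hχ1 hχ2 hprim, hχ, MulChar.ringHomComp_apply, ← hχ4, ZMod.card]
    push_cast
    rfl
  intro σ n hn hσ
  rw [hstar.2] at hσ
  have hσz := hσ.of_dvd (dvd_mul_left q 4) z hq1
  have hcop : n.Coprime q := by
    have : IsPrimitiveRoot (z ^ n) q := hσz ▸ hz.map_of_injective σ.injective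
    exact (hz.pow_iff_coprime (Nat.Prime.pos Fact.out) n).1 this
  have h1 : σ (gaussSum χ ψ) = gaussSum χ (ψ.mulShift n) := by
    rw [gaussSum, gaussSum, map_sum]
    refine Finset.sum_congr rfl fun x _ => ?_
    rw [map_mul]
    congr 1
    · rw [hχ, MulChar.ringHomComp_apply]
      exact map_intCast σ _
    · rw [AddChar.mulShift_apply, hψ, AddChar.zmodChar_apply, map_pow, hσz,
        ← ZMod.natCast_zmod_val x, ← Nat.cast_mul, AddChar.zmodChar_apply', ← pow_mul,
        ZMod.natCast_zmod_val x]
  have h2 := gaussSum_mulShift_eq χ ψ (ZMod.unitOfCoprime n hcop)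
  rw [ZMod.coe_unitOfCoprime] at h2
  rw [h1, h2, hχ2.inv, jacobiSym_eq_of_emod_four_eq_one hstar.1 hn, hstar.2,
    ← jacobiSym.legendreSym.to_jacobiSym, legendreSym, hχ, MulChar.ringHomComp_apply]
  simp

lemma sqrtReciprocity_prime (q : ℕ) (hq : q.Prime) : SqrtReciprocity q := by
  have : Fact q.Prime := ⟨hq⟩
  rcases eq_or_ne q 2 with rfl | h2
  · exact sqrtReciprocity_two
  have h := sqrtReciprocity_prime_star q h2
  rcases Nat.odd_mod_four_iff.1 (Nat.odd_iff.1 (hq.odd_of_ne_two h2)) with h1 | h3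
  · rwa [ZMod.χ₄_nat_one_mod_four h1, one_mul] at h
  · rw [ZMod.χ₄_nat_three_mod_four h3] at h
    simpa using sqrtReciprocity_neg_one.mul h

/-- The property holds for `-1` and the primes and is multiplicative. -/
theorem sqrtReciprocity {a : ℤ} (ha : a ≠ 0) : SqrtReciprocity a := by
  have hnat : ∀ m : ℕ, m ≠ 0 → SqrtReciprocity m := by
    intro m
    induction m using Nat.recOnMul with
    | zero => intro h; exact absurd rfl h
    | one => intro _; exact_mod_cast sqrtReciprocity_one
    | prime p hp => intro _; exact sqrtReciprocity_prime p hp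
    | mul b c hb hc =>
      intro h
      rw [Nat.cast_mul]
      exact (hb (left_ne_zero_of_mul h)).mul (hc (right_ne_zero_of_mul h))
  rcases Int.natAbs_eq a with h | h
  · rw [h]; exact hnat _ (Int.natAbs_ne_zero.2 ha)
  · rw [h, ← neg_one_mul]
    exact sqrtReciprocity_neg_one.mul (hnat _ (Int.natAbs_ne_zero.2 ha))

/-! ### Discriminants of quadratic fields -/

section Discriminant

open NumberField

variable {K : Type*} [Field K] [NumberField K]

lemma finrank_eq_two {s : K} {c : ℚ} (hs : s ^ 2 = c) (hc : ¬ IsSquare c)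
    (hspan : ∀ x : K, ∃ α β : ℚ, x = α + β * s) : Module.finrank ℚ K = 2 := by
  have hli : LinearIndependent ℚ ![(1 : K), s] := by
    rw [LinearIndependent.pair_iff]
    intro α β h
    rw [Rat.smul_def, Rat.smul_def, mul_one] at h
    have hβ : β = 0 := by
      by_contra hβ
      have hβ' : (β : K) ≠ 0 := by exact_mod_cast hβ
      refine hc ⟨α / β, ?_⟩
      have : (c : K) = ((α / β * (α / β) : ℚ) : K) := by
        rw [← hs]; push_cast
        field_simp
        linear_combination (β * s - α) * h
      exact_mod_cast this
    subst hβ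
    refine ⟨?_, rfl⟩
    simpa using h
  have hsp : ⊤ ≤ Submodule.span ℚ (Set.range ![(1 : K), s]) := by
    intro x _
    obtain ⟨α, β, rfl⟩ := hspan x
    rw [Matrix.range_cons, Matrix.range_cons, Matrix.range_empty, Set.union_empty,
      Set.singleton_union, Submodule.mem_span_pair]
    exact ⟨α, β, by rw [Rat.smul_def, Rat.smul_def, mul_one]⟩
  rw [Module.finrank_eq_card_basis (Module.Basis.mk hli hsp), Fintype.card_fin]

variable {E : Type*} [Field E] [Algebra ℚ E] [IsAlgClosed E]

/-- The discriminant of a quadratic field, in terms of its two embeddings. -/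
lemma exists_discr_eq_sq (h2 : Module.finrank ℚ K = 2) :
    ∃ (b : Fin 2 → 𝓞 K) (e : Fin 2 ≃ (K →ₐ[ℚ] E)),
      (discr K : E) = (e 0 (b 0) * e 1 (b 1) - e 0 (b 1) * e 1 (b 0)) ^ 2 := by
  classical
  have hι : Fintype.card (Module.Free.ChooseBasisIndex ℤ (𝓞 K)) = 2 := by
    rw [← Module.finrank_eq_card_basis (RingOfIntegers.basis K), RingOfIntegers.rank, h2]
  have hE : Fintype.card (K →ₐ[ℚ] E) = 2 := by rw [AlgHom.card, h2]
  let f := Fintype.equivFinOfCardEq hι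
  let e := (Fintype.equivFinOfCardEq hE).symm
  refine ⟨fun i => RingOfIntegers.basis K (f.symm i), e, ?_⟩
  have h1 : (discr K : ℚ) = Algebra.discr ℚ (integralBasis K ∘ f.symm) := by
    rw [coe_discr]
    exact (Algebra.discr_reindex ℚ (integralBasis K) f).symm
  have h3 := Algebra.discr_eq_det_embeddingsMatrixReindex_pow_two ℚ E (integralBasis K ∘ f.symm) e
  rw [← h1, map_intCast, Matrix.det_fin_two] at h3
  rw [h3]
  simp only [Algebra.embeddingsMatrixReindex, Algebra.embeddingsMatrix, integralBasis_apply,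
    Matrix.reindex_apply, Matrix.submatrix_apply, Matrix.of_apply, Function.comp_apply,
    Equiv.refl_symm, Equiv.coe_refl, id, Equiv.symm_symm]
  exact congrArg (· ^ 2) (congrArg₂ (· - ·) rfl (mul_comm _ _))

/-- Stickelberger's congruence for quadratic fields: the discriminant is `(P - N) ^ 2`, where `P`
and `N` are the two products in the expansion of the determinant of an integral basis. This equals
`(P + N) ^ 2 - 4 P N`, and `P + N` and `P N` are integers. -/
lemma discr_emod_four (h2 : Module.finrank ℚ K = 2) :
    discr K % 4 = 0 ∨ discr K % 4 = 1 := by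
  obtain ⟨b, e, h⟩ := exists_discr_eq_sq (E := AlgebraicClosure ℚ) h2
  have hint : ∀ i j, IsIntegral ℤ (e i (b j)) := fun i j =>
    (b j).isIntegral_coe.map (e i)
  have key : ∀ (x : AlgebraicClosure ℚ) (q : ℚ), IsIntegral ℤ x → algebraMap ℚ _ q = x →
      ∃ n : ℤ, (n : AlgebraicClosure ℚ) = x := by
    rintro x q hx rfl
    rw [isIntegral_algebraMap_iff (algebraMap ℚ (AlgebraicClosure ℚ)).injective] at hx
    obtain ⟨n, rfl⟩ := IsIntegrallyClosed.isIntegral_iff.1 hx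
    exact ⟨n, by simp⟩
  have htr : ∀ x : K, algebraMap ℚ (AlgebraicClosure ℚ) (Algebra.trace ℚ K x)
      = e 0 x + e 1 x := by
    intro x
    rw [trace_eq_sum_embeddings (AlgebraicClosure ℚ), ← e.sum_comp, Fin.sum_univ_two]
  have hnm : ∀ x : K, algebraMap ℚ (AlgebraicClosure ℚ) (Algebra.norm ℚ x)
      = e 0 x * e 1 x := by
    intro x
    rw [Algebra.norm_eq_prod_embeddings, ← e.prod_comp, Fin.prod_univ_two]
  obtain ⟨s, hs⟩ := key (e 0 (b 0) * e 1 (b 1) + e 0 (b 1) * e 1 (b 0))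
    (Algebra.trace ℚ K (b 0) * Algebra.trace ℚ K (b 1) - Algebra.trace ℚ K (b 0 * b 1))
    (((hint _ _).mul (hint _ _)).add ((hint _ _).mul (hint _ _))) (by
      rw [map_sub, map_mul, htr, htr, htr, map_mul, map_mul]; ring)
  obtain ⟨n, hn⟩ := key (e 0 (b 0) * e 1 (b 0) * (e 0 (b 1) * e 1 (b 1)))
    (Algebra.norm ℚ (b 0 : K) * Algebra.norm ℚ (b 1 : K))
    (((hint _ _).mul (hint _ _)).mul ((hint _ _).mul (hint _ _))) (by
      rw [map_mul, hnm, hnm])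
  have hd : discr K = s ^ 2 - 4 * n := by
    have : ((discr K : ℤ) : AlgebraicClosure ℚ) = ((s ^ 2 - 4 * n : ℤ) : AlgebraicClosure ℚ) := by
      push_cast
      rw [h, hs, hn]; ring
    exact_mod_cast this
  rcases Int.even_or_odd s with ⟨t, ht⟩ | ⟨t, ht⟩
  · left
    have : discr K = 4 * (t ^ 2 - n) := by rw [hd, ht]; ring
    omega
  · right
    have : discr K = 4 * (t ^ 2 + t - n) + 1 := by rw [hd, ht]; ring
    omega

/-- The discriminant of `ℚ(√c)` is `c` up to a rational square. -/
lemma discr_eq_sq_mul {s : K} {c : ℚ} (hs : s ^ 2 = c) (hc : ¬ IsSquare c)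
    (hspan : ∀ x : K, ∃ α β : ℚ, x = α + β * s) : ∃ q : ℚ, (discr K : ℚ) = q ^ 2 * c := by
  obtain ⟨b, e, h⟩ := exists_discr_eq_sq (E := AlgebraicClosure ℚ) (finrank_eq_two hs hc hspan)
  have hsq : ∀ i, e i s ^ 2 = (c : AlgebraicClosure ℚ) := by
    intro i; rw [← map_pow, hs, map_ratCast]
  have h1 : e 1 s = - e 0 s := by
    refine (sq_eq_sq_iff_eq_or_eq_neg.1 ((hsq 1).trans (hsq 0).symm)).resolve_left fun h01 => ?_
    have : e 1 = e 0 := by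
      ext x
      obtain ⟨α, β, rfl⟩ := hspan x
      simp only [map_add, map_mul, map_ratCast, h01]
    exact absurd (e.injective this) (by decide)
  obtain ⟨α, β, h0⟩ := hspan (b 0)
  obtain ⟨γ, ε, h0'⟩ := hspan (b 1)
  refine ⟨2 * (β * γ - α * ε), ?_⟩
  have : ((discr K : ℚ) : AlgebraicClosure ℚ)
      = (((2 * (β * γ - α * ε)) ^ 2 * c : ℚ) : AlgebraicClosure ℚ) := by
    rw [Rat.cast_intCast, h, h0, h0']
    simp only [map_add, map_mul, map_ratCast, h1]
    push_cast
    rw [← hsq 0]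
    ring
  exact_mod_cast this

end Discriminant

/-! ### The group of radicals -/

/-- A valuation `v_p` with `v_p(r) ≠ 0` embeds `R_∞ ∩ ℚ*` modulo `±1` in `ℤ`, so that this quotient
is infinite cyclic. -/
lemma exists_isRadicalGenerator {r : ℚˣ} (hr : r ≠ 1) (hr' : r ≠ -1) :
    ∃ r₀ : ℚˣ, IsRadicalGenerator r r₀ := by
  obtain ⟨p, hp, hpr⟩ : ∃ p : ℕ, p.Prime ∧ padicValRat p (r : ℚ) ≠ 0 := by
    by_contra! H
    have h1 : ∀ p : ℕ, p.Prime → padicValRat p |(r : ℚ)| = 0 := by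
      intro p hp
      rcases abs_choice (r : ℚ) with h | h <;> rw [h]
      · exact H p hp
      · rw [padicValRat.neg]; exact H p hp
    have hnum : (r : ℚ).num.natAbs = 1 := by
      by_contra hne
      obtain ⟨p, hp, hd⟩ := Nat.exists_prime_and_dvd hne
      have : Fact p.Prime := ⟨hp⟩
      have h2 := H p hp
      have h3 : ¬ p ∣ (r : ℚ).den := fun h =>
        hp.one_lt.ne' (Nat.dvd_one.1 ((r : ℚ).reduced ▸ Nat.dvd_gcd hd h))
      rw [padicValRat, padicValNat.eq_zero_of_not_dvd h3, Nat.cast_zero, sub_zero, padicValInt,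
        Nat.cast_eq_zero] at h2
      have h4 := one_le_padicValNat_of_dvd (Int.natAbs_ne_zero.2 (Rat.num_ne_zero.2 r.ne_zero)) hd
      omega
    have hden : (r : ℚ).den = 1 := by
      by_contra hne
      obtain ⟨p, hp, hd⟩ := Nat.exists_prime_and_dvd hne
      have : Fact p.Prime := ⟨hp⟩
      have h2 := H p hp
      rw [padicValRat, padicValInt, hnum, padicValNat_one_right, Nat.cast_zero, zero_sub,
        neg_eq_zero, Nat.cast_eq_zero] at h2
      have h4 := one_le_padicValNat_of_dvd (r : ℚ).den_ne_zero hd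
      omega
    have hr0 : (r : ℚ) = (r : ℚ).num := by
      conv_lhs => rw [← Rat.num_div_den (r : ℚ), hden]
      simp
    rcases Int.natAbs_eq_iff.1 hnum with h | h
    · exact hr (Units.ext (by rw [hr0, h]; simp))
    · exact hr' (Units.ext (by rw [hr0, h]; simp))
  have : Fact p.Prime := ⟨hp⟩
  let v : ℚˣ →* Multiplicative ℤ :=
    { toFun := fun q => Multiplicative.ofAdd (padicValRat p (q : ℚ))
      map_one' := by simp
      map_mul' := fun x y => by
        rw [Units.val_mul, padicValRat.mul x.ne_zero y.ne_zero, ofAdd_add] }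
  have hrmem : r ∈ ratRadicals r := ⟨1, one_pos, by
    rw [pow_one]; exact Subgroup.mem_zpowers _⟩
  -- the valuation at `p` is injective on radicals modulo sign
  have hker : ∀ q ∈ ratRadicals r, v q = 1 → q = 1 ∨ q = -1 := by
    rintro q ⟨k, hk, j, hj⟩ hv
    have hj' : r ^ j = q ^ k := by
      have : ratUnits (r ^ j) = ratUnits (q ^ k) := by rw [map_zpow, map_pow]; exact hj
      exact Units.map_injective (algebraMap ℚ Qbar).injective this
    have h1 : v r ^ j = 1 := by rw [← map_zpow, hj', map_pow, hv, one_pow]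
    have hj0 : j = 0 := by
      have : j * padicValRat p (r : ℚ) = 0 := by
        have := congrArg Multiplicative.toAdd h1
        rwa [toAdd_zpow, toAdd_one, smul_eq_mul] at this
      exact (mul_eq_zero.1 this).resolve_right hpr
    rw [hj0, zpow_zero] at hj'
    have h2 : |(q : ℚ)| ^ k = 1 := by
      rw [← abs_pow, ← Units.val_pow_eq_pow_val, ← hj', Units.val_one, abs_one]
    rw [pow_eq_one_iff_of_nonneg (abs_nonneg _) hk.ne'] at h2
    rcases (abs_eq one_pos.le).1 h2 with h | h
    · exact Or.inl (Units.ext h)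
    · exact Or.inr (Units.ext (by rw [h]; simp))
  obtain ⟨g, hg⟩ : ∃ g, (ratRadicals r).map v = Subgroup.zpowers g :=
    (Subgroup.isCyclic_iff_exists_zpowers_eq_top _).1 inferInstance |>.imp fun _ h => h.symm
  obtain ⟨r₀, hr₀, hvr₀⟩ : g ∈ (ratRadicals r).map v := hg ▸ Subgroup.mem_zpowers g
  have hneg : (-1 : ℚˣ) ∈ ratRadicals r := ⟨2, two_pos, by
    rw [← map_pow]; simp⟩
  refine ⟨r₀, le_antisymm ?_ ?_, ?_⟩
  · rw [sup_le_iff, Subgroup.zpowers_le, Subgroup.zpowers_le]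
    exact ⟨hr₀, hneg⟩
  · intro q hq
    obtain ⟨m, hm⟩ : v q ∈ Subgroup.zpowers g := hg ▸ Subgroup.mem_map_of_mem v hq
    have h1 : v (r₀ ^ (-m) * q) = 1 := by
      rw [map_mul, map_zpow, hvr₀, ← hm, zpow_neg, inv_mul_cancel]
    have h2 := hker _ (mul_mem (zpow_mem hr₀ _) hq) h1
    have h3 : q = r₀ ^ m * (r₀ ^ (-m) * q) := by rw [zpow_neg, mul_inv_cancel_left]
    rw [h3]
    refine Subgroup.mul_mem_sup ⟨m, rfl⟩ ?_
    rcases h2 with h | h <;> rw [h]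
    · exact one_mem _
    · exact Subgroup.mem_zpowers _
  · rw [Subgroup.disjoint_def]
    rintro x ⟨m, rfl⟩ hx
    have hv1 : v (r₀ ^ m) = 1 := by
      obtain ⟨n, hn⟩ := hx
      have : v (-1) = 1 := by
        change Multiplicative.ofAdd (padicValRat p ((-1 : ℚˣ) : ℚ)) = 1
        simp
      have h' : v (r₀ ^ m) = v ((-1) ^ n) := congrArg v hn.symm
      rw [h', map_zpow, this, one_zpow]
    have hv2 : Multiplicative.toAdd (v r₀) ≠ 0 := by
      intro h0
      obtain ⟨n, hn⟩ : v r ∈ Subgroup.zpowers g := hg ▸ Subgroup.mem_map_of_mem v hrmem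
      have hg1 : g = 1 := by rw [← hvr₀]; exact Multiplicative.toAdd.injective h0
      apply hpr
      have h5 : v r = 1 := by rw [← hn, hg1]; exact one_zpow n
      exact congrArg Multiplicative.toAdd h5
    have hm : m = 0 := by
      have := congrArg Multiplicative.toAdd hv1
      rw [map_zpow, toAdd_zpow, toAdd_one, smul_eq_mul] at this
      exact (mul_eq_zero.1 this).resolve_right hv2
    change r₀ ^ m = 1
    rw [hm, zpow_zero]

/-- The multiplicative group of an algebraically closed field is divisible, so every element is
the value at `1` of a homomorphism from `ℚ`. -/
lemma exists_ratHom (c : Qbarˣ) :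
    ∃ ρ : Multiplicative ℚ →* Qbarˣ, ρ (Multiplicative.ofAdd 1) = c := by
  have hsurj : ∀ {n : ℤ}, n ≠ 0 → Function.Surjective fun a : Additive Qbarˣ => n • a := by
    intro n hn a
    have hnat : ∀ b : Qbarˣ, ∃ y : Qbarˣ, y ^ n.natAbs = b := by
      intro b
      obtain ⟨y, hy⟩ := IsAlgClosed.exists_pow_nat_eq (b : Qbar) (Int.natAbs_pos.2 hn)
      have hy0 : y ≠ 0 := by
        rintro rfl
        rw [zero_pow (Int.natAbs_ne_zero.2 hn)] at hy
        exact b.ne_zero hy.symm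
      exact ⟨Units.mk0 y hy0, Units.ext (by simpa using hy)⟩
    rcases Int.natAbs_eq n with h | h
    · obtain ⟨y, hy⟩ := hnat a.toMul
      refine ⟨Additive.ofMul y, ?_⟩
      change n • Additive.ofMul y = a
      rw [h, natCast_zsmul, ← ofMul_pow, hy, ofMul_toMul]
    · obtain ⟨y, hy⟩ := hnat a.toMul⁻¹
      refine ⟨Additive.ofMul y, ?_⟩
      change n • Additive.ofMul y = a
      rw [h, neg_smul, natCast_zsmul, ← ofMul_pow, hy, ofMul_inv, neg_neg, ofMul_toMul]
  let _ : DivisibleBy (Additive Qbarˣ) ℤ := divisibleByOfSMulRightSurj _ _ hsurj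
  obtain ⟨f, hf⟩ := (Module.Baer.of_divisible (Additive Qbarˣ)).extension_property_addMonoidHom
    (Int.castAddHom ℚ) Int.cast_injective (zmultiplesHom _ (Additive.ofMul c))
  refine ⟨AddMonoidHom.toMultiplicativeLeft f, ?_⟩
  have h1 : f 1 = Additive.ofMul c := by
    have := DFunLike.congr_fun hf (1 : ℤ)
    simpa using this
  change (f 1).toMul = c
  rw [h1]; rfl

section Generator

variable {r r₀ : ℚˣ}

lemma ratUnits_injective : Function.Injective ratUnits :=
  Units.map_injective (algebraMap ℚ Qbar).injective

lemma mem_ratRadicals_of_pow_mem {q : ℚˣ} {k : ℕ} (hk : 0 < k) (h : q ^ k ∈ ratRadicals r) :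
    q ∈ ratRadicals r := by
  obtain ⟨l, hl, hq⟩ := h
  exact ⟨k * l, Nat.mul_pos hk hl, by rwa [pow_mul, ← map_pow]⟩

lemma IsRadicalGenerator.mem (h : IsRadicalGenerator r r₀) : r₀ ∈ ratRadicals r :=
  h.1 ▸ Subgroup.mem_sup_left (Subgroup.mem_zpowers r₀)

lemma IsRadicalGenerator.eq_or_eq_neg (h : IsRadicalGenerator r r₀) {q : ℚˣ}
    (hq : q ∈ ratRadicals r) : ∃ m : ℤ, q = r₀ ^ m ∨ q = -r₀ ^ m := by
  rw [← h.1, Subgroup.mem_sup] at hq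
  obtain ⟨_, ⟨m, rfl⟩, _, ⟨n, rfl⟩, rfl⟩ := hq
  refine ⟨m, ?_⟩
  rcases Int.even_or_odd n with hn | hn
  · left; simp [hn.neg_one_zpow]
  · right; simp [hn.neg_one_zpow]

lemma self_mem_ratRadicals : r ∈ ratRadicals r :=
  ⟨1, one_pos, by rw [pow_one]; exact Subgroup.mem_zpowers _⟩

lemma IsRadicalGenerator.eq_zero_of_zpow (h : IsRadicalGenerator r r₀) (hr : r ≠ 1) (hr' : r ≠ -1)
    {m : ℤ} (hm : r₀ ^ m = 1) : m = 0 := by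
  by_contra hm0
  have habs : |(r₀ : ℚ)| ^ m.natAbs = 1 := by
    have h1 : r₀ ^ m.natAbs = 1 := by
      rcases Int.natAbs_eq m with h | h <;> rw [h] at hm
      · rwa [zpow_natCast] at hm
      · rwa [zpow_neg, inv_eq_one, zpow_natCast] at hm
    rw [← abs_pow, ← Units.val_pow_eq_pow_val, h1, Units.val_one, abs_one]
  rw [pow_eq_one_iff_of_nonneg (abs_nonneg _) (Int.natAbs_ne_zero.2 hm0)] at habs
  have hsq : r₀ ^ 2 = 1 := by
    apply Units.ext
    rw [Units.val_pow_eq_pow_val, ← sq_abs, habs]; simp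
  have hr1 : r ^ 2 = 1 := by
    obtain ⟨k, hk⟩ := h.eq_or_eq_neg self_mem_ratRadicals
    have : r ^ 2 = (r₀ ^ 2) ^ k := by
      rw [← zpow_natCast r₀, ← zpow_mul, mul_comm, zpow_mul, zpow_natCast]
      rcases hk with hk | hk <;> rw [hk]
      rw [neg_sq]
    rw [this, hsq, one_zpow]
  have hr2 : (r : ℚ) ^ 2 = 1 := by rw [← Units.val_pow_eq_pow_val, hr1, Units.val_one]
  rcases sq_eq_one_iff.1 hr2 with h | h
  · exact hr (Units.ext h)
  · exact hr' (Units.ext (by simpa using h))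

/-- `r₀` is not a square, because it is not divisible by `2` in `R_∞ ∩ ℚ*`. -/
lemma IsRadicalGenerator.not_isSquare (h : IsRadicalGenerator r r₀) (hr : r ≠ 1) (hr' : r ≠ -1) :
    ¬ IsSquare (r₀ : ℚ) := by
  rintro ⟨x, hx⟩
  have hx0 : x ≠ 0 := by
    rintro rfl
    simp at hx
  have hx2 : (Units.mk0 x hx0) ^ 2 = r₀ := Units.ext (by simp [hx, sq])
  obtain ⟨m, hm⟩ := h.eq_or_eq_neg
    (mem_ratRadicals_of_pow_mem (q := Units.mk0 x hx0) two_pos (hx2 ▸ h.mem))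
  have h1 : r₀ ^ (m * 2 - 1) = 1 := by
    have : r₀ ^ (m * 2) = r₀ := by
      conv_rhs => rw [← hx2]
      rw [zpow_mul, zpow_ofNat]
      rcases hm with hm | hm <;> rw [hm]
      rw [neg_sq]
    rw [zpow_sub_one, this, mul_inv_cancel]
  have := h.eq_zero_of_zpow hr hr' h1
  omega

end Generator

/-! ### Rational powers of the generator -/

section RationalPower

variable {r r₀ : ℚˣ} {ρ : Multiplicative ℚ →* Qbarˣ}

lemma rpow_add (a b : ℚ) : rpow ρ (a + b) = rpow ρ a * rpow ρ b := by
  rw [rpow, ofAdd_add, map_mul]; rfl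

lemma rpow_zero : rpow ρ 0 = 1 := by rw [rpow, ofAdd_zero, map_one]

lemma rpow_mul_int (a : ℚ) (n : ℤ) : rpow ρ (a * n) = rpow ρ a ^ n := by
  rw [rpow, rpow, ← map_zpow, ← ofAdd_zsmul, zsmul_eq_mul, mul_comm]

lemma rpow_mul_nat (a : ℚ) (n : ℕ) : rpow ρ (a * n) = rpow ρ a ^ n := by
  exact_mod_cast rpow_mul_int a n

lemma IsRationalPower.rpow_int (hρ : IsRationalPower r₀ ρ) (n : ℤ) :
    rpow ρ n = ratUnits (r₀ ^ n) := by
  rw [map_zpow, ← hρ.2, ← one_mul (n : ℚ), rpow_mul_int]; rfl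

lemma exists_isRationalPower (h : IsRadicalGenerator r r₀) (hr : r ≠ 1) (hr' : r ≠ -1) :
    ∃ ρ : Multiplicative ℚ →* Qbarˣ, IsRationalPower r₀ ρ := by
  obtain ⟨ρ, hρ⟩ := exists_ratHom (ratUnits r₀)
  refine ⟨ρ, (injective_iff_map_eq_one ρ).2 fun a ha => ?_, hρ⟩
  have h1 : rpow ρ (a.toAdd * a.toAdd.den) = 1 := by
    rw [rpow_mul_nat]
    change ρ a ^ _ = 1
    rw [ha, one_pow]
  rw [Rat.mul_den_eq_num, ← one_mul (a.toAdd.num : ℚ), rpow_mul_int] at h1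
  have h2 : ratUnits (r₀ ^ a.toAdd.num) = 1 := by rw [map_zpow, ← hρ]; exact h1
  have h3 := h.eq_zero_of_zpow hr hr' (ratUnits_injective (h2.trans (map_one _).symm))
  exact Rat.num_eq_zero.1 h3

lemma IsRationalPower.rpow_inv_pow (hρ : IsRationalPower r₀ ρ) (n : ℕ+) :
    rpow ρ (1 / (n : ℚ)) ^ (n : ℕ) = ratUnits r₀ := by
  have hn : ((n : ℕ) : ℚ) ≠ 0 := by exact_mod_cast n.ne_zero
  rw [← rpow_mul_nat, one_div_mul_cancel hn, ← hρ.2]; rfl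

lemma IsRationalPower.eq_zero_of_pow (hρ : IsRationalPower r₀ ρ) {a : ℚ} {n : ℕ} (hn : n ≠ 0)
    (h : rpow ρ a ^ n = 1) : a = 0 := by
  rw [← rpow_mul_nat] at h
  have h1 : Multiplicative.ofAdd (a * n) = 1 := hρ.1 (by rw [map_one]; exact h)
  have h2 : a * n = 0 := h1
  exact (mul_eq_zero.1 h2).resolve_right (by exact_mod_cast hn)

lemma IsRationalPower.rpow_mem (hρ : IsRationalPower r₀ ρ) (h : IsRadicalGenerator r r₀) (a : ℚ) :
    rpow ρ a ∈ radicals r := by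
  obtain ⟨k, hk, j, hj⟩ := h.mem
  have h1 : rpow ρ a ^ a.den = ratUnits r₀ ^ a.num := by
    rw [← rpow_mul_nat, Rat.mul_den_eq_num, hρ.rpow_int, map_zpow]
  refine ⟨a.den * k, Nat.mul_pos a.den_pos hk, j * a.num, ?_⟩
  change ratUnits r ^ (j * a.num) = _
  have hj' : ratUnits r ^ j = ratUnits r₀ ^ k := hj
  rw [pow_mul, h1, zpow_mul, hj', ← zpow_natCast, ← zpow_natCast, ← zpow_mul, ← zpow_mul, mul_comm]

lemma mem_radicals_of_pow_eq_one {z : Qbarˣ} {n : ℕ} (hn : n ≠ 0) (h : z ^ n = 1) :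
    z ∈ radicals r :=
  ⟨n, Nat.pos_of_ne_zero hn, h ▸ one_mem _⟩

/-- Every radical is a root of unity times a rational power of `r₀`. -/
lemma IsRationalPower.exists_torsion (hρ : IsRationalPower r₀ ρ) (h : IsRadicalGenerator r r₀)
    {y : Qbarˣ} (hy : y ∈ radicals r) :
    ∃ (a : ℚ) (n : ℕ+), (y * (rpow ρ a)⁻¹) ^ (n : ℕ) = 1 := by
  obtain ⟨k, hk, j, hj⟩ := hy
  obtain ⟨m, hm⟩ := h.eq_or_eq_neg (zpow_mem self_mem_ratRadicals j)
  have hj' : ratUnits (r ^ j) = y ^ k := by rw [map_zpow]; exact hj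
  have hy2 : y ^ (k * 2) = ratUnits r₀ ^ (m * 2) := by
    rw [pow_mul, ← hj', ← map_pow, zpow_mul, ← map_zpow]
    rcases hm with hm | hm <;> rw [hm]
    · rw [← map_zpow]; rfl
    · rw [neg_sq, ← map_zpow]; rfl
  have hk0 : (k : ℚ) ≠ 0 := by exact_mod_cast hk.ne'
  refine ⟨m / k, ⟨k * 2, by omega⟩, ?_⟩
  have h3 : rpow ρ (m / k) ^ (k * 2) = ratUnits r₀ ^ (m * 2) := by
    rw [← rpow_mul_nat, ← map_zpow, ← hρ.rpow_int]
    congr 1; push_cast; field_simp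
  rw [PNat.mk_coe, mul_pow, inv_pow, hy2, h3, mul_inv_cancel]

end RationalPower

/-! ### The affine group acting on radicals -/

section Affine

variable {r r₀ : ℚˣ} {ρ : Multiplicative ℚ →* Qbarˣ}

lemma component_mul (x y : TateModule) (n : ℕ+) :
    component (x * y) n = component x n * component y n := rfl

lemma component_one (n : ℕ+) : component 1 n = 1 := rfl

lemma component_mul_pow (x : TateModule) (m n : ℕ+) :
    component x (m * n) ^ (m : ℕ) = component x n := x.2 m n

/-- The value `x_n ^ m` depends only on the fraction `m / n`. -/
lemma component_zpow_eq (x : TateModule) {m m' : ℤ} {n n' : ℕ+}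
    (h : m * (n' : ℕ) = m' * (n : ℕ)) : component x n ^ m = component x n' ^ m' := by
  have h1 := component_mul_pow x n' n
  have h2 := component_mul_pow x n n'
  rw [mul_comm n n'] at h2
  rw [← h1, ← h2, ← zpow_natCast, ← zpow_natCast, ← zpow_mul, ← zpow_mul, mul_comm _ m, h,
    mul_comm _ m']

/-- The homomorphism `m / n ↦ x_n ^ m` attached to an element of the Tate module. -/
def tateHom (x : TateModule) : Multiplicative ℚ →* Qbarˣ :=
  MonoidHom.mk' (fun q => component x q.toAdd.pnatDen ^ q.toAdd.num) (by
    intro a b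
    generalize hα : a.toAdd = α
    generalize hβ : b.toAdd = β
    rw [toAdd_mul, hα, hβ]
    have hN : ((α.pnatDen * β.pnatDen : ℕ+) : ℕ) = α.den * β.den := rfl
    rw [component_zpow_eq x (m := (α + β).num) (m' := α.num * β.den + β.num * α.den)
        (n' := α.pnatDen * β.pnatDen),
      component_zpow_eq x (m := α.num) (m' := α.num * β.den) (n' := α.pnatDen * β.pnatDen),
      component_zpow_eq x (m := β.num) (m' := β.num * α.den) (n' := α.pnatDen * β.pnatDen),
      zpow_add]
    · simp only [Rat.coe_pnatDen, hN]; push_cast; ring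
    · simp only [Rat.coe_pnatDen, hN]; push_cast; ring
    · simp only [Rat.coe_pnatDen, hN]
      have : (((α + β).num * (α.den * β.den : ℕ) : ℤ) : ℚ)
          = (((α.num * β.den + β.num * α.den) * (α + β).den : ℤ) : ℚ) := by
        push_cast
        rw [← Rat.mul_den_eq_num (α + β), ← Rat.mul_den_eq_num α, ← Rat.mul_den_eq_num β]
        ring
      exact_mod_cast this)

lemma tateHom_ofAdd (x : TateModule) (q : ℚ) :
    tateHom x (Multiplicative.ofAdd q) = component x q.pnatDen ^ q.num := rfl

lemma tateHom_inv (x : TateModule) (n : ℕ+) :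
    tateHom x (Multiplicative.ofAdd (1 / (n : ℚ))) = component x n := by
  have hn : ((n : ℕ) : ℚ) ≠ 0 := by exact_mod_cast n.ne_zero
  rw [tateHom_ofAdd]
  generalize hq : 1 / (n : ℚ) = q
  conv_rhs => rw [← zpow_one (component x n)]
  refine component_zpow_eq x ?_
  have : ((q.num * (n : ℕ) : ℤ) : ℚ) = ((1 * q.den : ℤ) : ℚ) := by
    push_cast
    rw [← Rat.mul_den_eq_num q, ← hq]
    field_simp
  exact_mod_cast this

lemma tateHom_pow_den (x : TateModule) (q : ℚ) :
    tateHom x (Multiplicative.ofAdd q) ^ q.den = 1 := by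
  have := component_pow x q.pnatDen
  rw [Rat.coe_pnatDen] at this
  rw [tateHom_ofAdd, ← zpow_natCast, ← zpow_mul, mul_comm, zpow_mul, zpow_natCast, this, one_zpow]

lemma pow_residue_eq {z : Qbarˣ} {m n : ℕ+} (hm : z ^ (m : ℕ) = 1) (hn : z ^ (n : ℕ) = 1)
    (u : ZHatˣ) : z ^ residue u m = z ^ residue u n := by
  have key : ∀ {m n : ℕ+}, z ^ (m : ℕ) = 1 → (m : ℕ) ∣ n → z ^ residue u m = z ^ residue u n :=
    fun hm h => pow_eq_of_cast hm (residue_cast_of_dvd u h).symm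
  have h1 := key hm (n := m * n) (by rw [PNat.mul_coe]; exact dvd_mul_right _ _)
  have h2 := key hn (n := m * n) (by rw [PNat.mul_coe]; exact dvd_mul_left _ _)
  rw [h1, h2]

/-- The action of `(x, u)` on a product `z * r₀ ^ a` of a root of unity and a rational power,
through chosen `a` and a chosen exponent of `z`. -/
def affAct (hρ : IsRationalPower r₀ ρ) (h : IsRadicalGenerator r r₀) (x : TateModule) (u : ZHatˣ)
    (y : radicals r) : Qbarˣ :=
  let a := (hρ.exists_torsion h y.2).choose
  let n := (hρ.exists_torsion h y.2).choose_spec.choose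
  ((y : Qbarˣ) * (rpow ρ a)⁻¹) ^ residue u n * (tateHom x (Multiplicative.ofAdd a) * rpow ρ a)

/-- The exponent `a` is unique, and the exponent of the root of unity is irrelevant. -/
lemma affAct_eq (hρ : IsRationalPower r₀ ρ) (h : IsRadicalGenerator r r₀) (x : TateModule)
    (u : ZHatˣ) (y : radicals r) {a : ℚ} {n : ℕ+}
    (hy : ((y : Qbarˣ) * (rpow ρ a)⁻¹) ^ (n : ℕ) = 1) :
    affAct hρ h x u y = ((y : Qbarˣ) * (rpow ρ a)⁻¹) ^ residue u n *
      (tateHom x (Multiplicative.ofAdd a) * rpow ρ a) := by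
  have hspec := (hρ.exists_torsion h y.2).choose_spec.choose_spec
  rw [affAct]
  generalize (hρ.exists_torsion h y.2).choose_spec.choose = m at *
  generalize (hρ.exists_torsion h y.2).choose = b at *
  have hab : b = a := by
    have h1 : rpow ρ (b - a) ^ ((m : ℕ) * n) = 1 := by
      have h2 : rpow ρ (b - a) = ((y : Qbarˣ) * (rpow ρ a)⁻¹) * ((y : Qbarˣ) * (rpow ρ b)⁻¹)⁻¹ := by
        have : rpow ρ b = rpow ρ (b - a) * rpow ρ a := by rw [← rpow_add, sub_add_cancel]
        rw [mul_inv, inv_inv, mul_mul_mul_comm, mul_inv_cancel, one_mul, this, mul_left_comm,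
          inv_mul_cancel, mul_one]
      rw [h2, mul_pow, inv_pow, pow_mul ((y : Qbarˣ) * (rpow ρ b)⁻¹), hspec, mul_comm (m : ℕ),
        pow_mul, hy, one_pow, one_pow, inv_one, one_mul]
    have := hρ.eq_zero_of_pow (Nat.mul_ne_zero m.ne_zero n.ne_zero) h1
    linarith
  subst hab
  rw [pow_residue_eq hspec hy]

/-- The action of `(x, u)` on the radicals as an endomorphism. -/
def affHom (hρ : IsRationalPower r₀ ρ) (h : IsRadicalGenerator r r₀) (x : TateModule)
    (u : ZHatˣ) : radicals r →* radicals r :=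
  MonoidHom.mk' (fun y => ⟨affAct hρ h x u y, by
    obtain ⟨a, n, hy⟩ := hρ.exists_torsion h y.2
    rw [affAct_eq hρ h x u y hy]
    exact mul_mem (pow_mem (mem_radicals_of_pow_eq_one n.ne_zero hy) _)
      (mul_mem (mem_radicals_of_pow_eq_one a.den_ne_zero (tateHom_pow_den x a))
        (hρ.rpow_mem h a))⟩) (by
    intro y z
    apply Subtype.ext
    obtain ⟨a, n, hy⟩ := hρ.exists_torsion h y.2
    obtain ⟨b, m, hz⟩ := hρ.exists_torsion h z.2
    have hyz : ((y * z : radicals r) : Qbarˣ) * (rpow ρ (a + b))⁻¹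
        = (y * (rpow ρ a)⁻¹) * (z * (rpow ρ b)⁻¹) := by
      rw [rpow_add, mul_inv, Subgroup.coe_mul]; exact mul_mul_mul_comm _ _ _ _
    have hy' : ((y : Qbarˣ) * (rpow ρ a)⁻¹) ^ ((n * m : ℕ+) : ℕ) = 1 := by
      rw [PNat.mul_coe, pow_mul, hy, one_pow]
    have hz' : ((z : Qbarˣ) * (rpow ρ b)⁻¹) ^ ((n * m : ℕ+) : ℕ) = 1 := by
      rw [PNat.mul_coe, mul_comm (n : ℕ), pow_mul, hz, one_pow]
    change affAct hρ h x u (y * z) = affAct hρ h x u y * affAct hρ h x u z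
    rw [affAct_eq hρ h x u y hy', affAct_eq hρ h x u z hz',
      affAct_eq hρ h x u (y * z) (a := a + b) (n := n * m)
        (by rw [hyz, mul_pow, hy', hz', one_mul]),
      hyz, mul_pow, rpow_add, ofAdd_add, map_mul]
    simp only [mul_assoc, mul_left_comm, mul_comm])

lemma affHom_torsion (hρ : IsRationalPower r₀ ρ) (h : IsRadicalGenerator r r₀) (x : TateModule)
    (u : ZHatˣ) {z : radicals r} {n : ℕ+} (hz : z ^ (n : ℕ) = 1) :
    affHom hρ h x u z = z ^ residue u n := by
  apply Subtype.ext
  have hz' : ((z : Qbarˣ) * (rpow ρ 0)⁻¹) ^ (n : ℕ) = 1 := by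
    rw [rpow_zero, inv_one, mul_one, ← Subgroup.coe_pow, hz, Subgroup.coe_one]
  change affAct hρ h x u z = _
  rw [affAct_eq hρ h x u z hz', rpow_zero, ofAdd_zero, map_one]
  simp

lemma affHom_root (hρ : IsRationalPower r₀ ρ) (h : IsRadicalGenerator r r₀) (x : TateModule)
    (u : ZHatˣ) {y : radicals r} {n : ℕ+} (hy : (y : Qbarˣ) = rpow ρ (1 / (n : ℚ))) :
    (affHom hρ h x u y : Qbarˣ) = component x n * y := by
  have hy' : ((y : Qbarˣ) * (rpow ρ (1 / (n : ℚ)))⁻¹) ^ ((1 : ℕ+) : ℕ) = 1 := by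
    rw [hy, mul_inv_cancel, one_pow]
  change affAct hρ h x u y = _
  rw [affAct_eq hρ h x u y hy', tateHom_inv, hy, mul_inv_cancel, one_pow, one_mul]

/-- Every radical is `z * (r₀ ^ (1/n)) ^ m` for a root of unity `z`. -/
lemma exists_eq_mul_zpow (hρ : IsRationalPower r₀ ρ) (h : IsRadicalGenerator r r₀)
    (y : radicals r) : ∃ (z w : radicals r) (k n : ℕ+) (m : ℤ), z ^ (k : ℕ) = 1 ∧
      (w : Qbarˣ) = rpow ρ (1 / (n : ℚ)) ∧ y = z * w ^ m := by
  obtain ⟨a, k, hk⟩ := hρ.exists_torsion h y.2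
  refine ⟨⟨_, mem_radicals_of_pow_eq_one k.ne_zero hk⟩, ⟨_, hρ.rpow_mem h _⟩, k,
    a.pnatDen, a.num, Subtype.ext hk, rfl, Subtype.ext ?_⟩
  change (y : Qbarˣ) = y * (rpow ρ a)⁻¹ * rpow ρ (1 / (a.den : ℚ)) ^ a.num
  have : rpow ρ (1 / (a.den : ℚ)) ^ a.num = rpow ρ a := by
    rw [← rpow_mul_int]
    congr 1
    conv_rhs => rw [← Rat.num_div_den a]
    ring
  rw [this, inv_mul_cancel_right]

/-- Homomorphisms on the group of radicals are determined by their values at roots of unity and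
at the roots `r₀ ^ (1/n)`. -/
lemma radicals_hom_ext (hρ : IsRationalPower r₀ ρ) (h : IsRadicalGenerator r r₀) {M : Type*}
    [Group M] {f g : radicals r →* M}
    (htors : ∀ (z : radicals r) (n : ℕ+), z ^ (n : ℕ) = 1 → f z = g z)
    (hroot : ∀ (y : radicals r) (n : ℕ+), (y : Qbarˣ) = rpow ρ (1 / (n : ℚ)) → f y = g y) :
    f = g := by
  ext1 y
  obtain ⟨z, w, k, n, m, hz, hw, rfl⟩ := exists_eq_mul_zpow hρ h y
  rw [map_mul, map_mul, map_zpow, map_zpow, htors z k hz, hroot w n hw]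

lemma affHom_mul (hρ : IsRationalPower r₀ ρ) (h : IsRadicalGenerator r r₀) (p q : AffineGroup) :
    affHom hρ h (p * q).left (p * q).right
      = (affHom hρ h p.left p.right).comp (affHom hρ h q.left q.right) := by
  apply radicals_hom_ext hρ h
  · intro z n hz
    have hz' : (z ^ residue q.right n) ^ (n : ℕ) = 1 := by
      rw [← pow_mul, mul_comm, pow_mul, hz, one_pow]
    rw [MonoidHom.comp_apply, affHom_torsion _ _ _ _ hz, affHom_torsion _ _ _ _ hz,
      affHom_torsion _ _ _ _ hz', SemidirectProduct.mul_right, ← pow_mul,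
      mul_comm (residue q.right n)]
    apply Subtype.ext
    exact pow_eq_of_cast (congrArg Subtype.val hz) (residue_mul _ _ n)
  · intro y n hy
    apply Subtype.ext
    have hc := component_pow q.left n
    have hq : affHom hρ h q.left q.right y
        = ⟨component q.left n, mem_radicals_of_pow_eq_one n.ne_zero hc⟩ * y :=
      Subtype.ext (affHom_root hρ h _ _ hy)
    rw [MonoidHom.comp_apply, affHom_root _ _ _ _ hy, hq, map_mul,
      affHom_torsion hρ h p.left p.right (n := n) (Subtype.ext hc), Subgroup.coe_mul,
      affHom_root _ _ _ _ hy, SemidirectProduct.mul_left, component_mul]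
    change component p.left n * component q.left n ^ residue p.right n * y
      = component q.left n ^ residue p.right n * (component p.left n * y)
    rw [mul_comm (component p.left n), mul_assoc]

lemma affHom_one (hρ : IsRationalPower r₀ ρ) (h : IsRadicalGenerator r r₀) :
    affHom hρ h 1 1 = MonoidHom.id (radicals r) := by
  apply radicals_hom_ext hρ h
  · intro z n hz
    rw [affHom_torsion _ _ _ _ hz]
    apply Subtype.ext
    exact (pow_eq_of_cast (congrArg Subtype.val hz) (residue_one n)).trans (pow_one _)
  · intro y n hy
    apply Subtype.ext
    rw [affHom_root _ _ _ _ hy, component_one, one_mul]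
    rfl

/-- The action of an element of the affine group as an automorphism of the group of radicals. -/
def affAut (hρ : IsRationalPower r₀ ρ) (h : IsRadicalGenerator r r₀) (p : AffineGroup) :
    MulAut (radicals r) :=
  MonoidHom.toMulEquiv (affHom hρ h p.left p.right) (affHom hρ h p⁻¹.left p⁻¹.right)
    (by rw [← affHom_mul, inv_mul_cancel]; exact affHom_one hρ h)
    (by rw [← affHom_mul, mul_inv_cancel]; exact affHom_one hρ h)

lemma exists_radical_of_rat (h : IsRadicalGenerator r r₀) {y : radicals r}
    (hy : (y : Qbarˣ) ∈ ratUnits.range) :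
    ∃ m : ℤ, (y : Qbarˣ) = ratUnits r₀ ^ m ∨ (y : Qbarˣ) = -ratUnits r₀ ^ m := by
  obtain ⟨q, hq⟩ := hy
  obtain ⟨m, hm⟩ := h.eq_or_eq_neg (q := q) (by
    change ratUnits q ∈ radicals r
    rw [hq]; exact y.2)
  refine ⟨m, ?_⟩
  rw [← hq, ← map_zpow]
  refine hm.imp (fun h => by rw [h]) fun h => ?_
  rw [h]
  ext
  simp [ratUnits]

lemma residue_coprime (u : ZHatˣ) (n : ℕ+) : (residue u n).Coprime n := by
  rw [← ZMod.isUnit_iff_coprime, residue_cast]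
  exact (u.isUnit.map ((Pi.evalRingHom (fun n : ℕ+ => ZMod n) n).comp ZHat.subtype))

lemma affAut_mem (hρ : IsRationalPower r₀ ρ) (h : IsRadicalGenerator r r₀) (p : AffineGroup) :
    affAut hρ h p ∈ radicalAut r := by
  intro y hy
  change affHom hρ h p.left p.right y = y
  let w : radicals r := ⟨ratUnits r₀, h.mem⟩
  have hw : affHom hρ h p.left p.right w = w := by
    apply Subtype.ext
    rw [affHom_root hρ h p.left p.right (n := 1) (by
      have := hρ.rpow_inv_pow 1
      rw [PNat.one_coe, pow_one] at this
      exact this.symm)]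
    have := component_pow p.left 1
    rw [PNat.one_coe, pow_one] at this
    rw [this, one_mul]
  let e : radicals r := ⟨-1, mem_radicals_of_pow_eq_one two_ne_zero (by simp)⟩
  have he2 : e ^ ((2 : ℕ+) : ℕ) = 1 := Subtype.ext (by simp [e])
  have he : affHom hρ h p.left p.right e = e := by
    rw [affHom_torsion hρ h _ _ he2]
    have : Odd (residue p.right 2) := by
      have := residue_coprime p.right 2
      rwa [Nat.coprime_comm, PNat.val_ofNat, Nat.coprime_two_left] at this
    obtain ⟨k, hk⟩ := this
    rw [PNat.val_ofNat] at he2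
    rw [hk, pow_succ, pow_mul, he2, one_pow, one_mul]
  obtain ⟨m, hm | hm⟩ := exists_radical_of_rat h hy
  · have : y = w ^ m := Subtype.ext hm
    rw [this, map_zpow, hw]
  · have : y = e * w ^ m := Subtype.ext (by rw [hm]; simp [e, w])
    rw [this, map_mul, map_zpow, hw, he]

end Affine

/-! ### The parameters of an automorphism of the radicals -/

section Inverse

variable {r r₀ : ℚˣ} {ρ : Multiplicative ℚ →* Qbarˣ}

lemma exists_primitive_radical (r : ℚˣ) (n : ℕ+) :
    ∃ z : radicals r, IsPrimitiveRoot (z : Qbarˣ) n := by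
  obtain ⟨z, hz⟩ := exists_primitive n n.ne_zero
  have hu : IsPrimitiveRoot (hz.isUnit n.ne_zero).unit (n : ℕ) :=
    hz.isUnit_unit n.ne_zero
  exact ⟨⟨_, mem_radicals_of_pow_eq_one n.ne_zero hu.pow_eq_one⟩, hu⟩

/-- A chosen primitive `n`-th root of unity. -/
def zetaRad (r : ℚˣ) (n : ℕ+) : radicals r := (exists_primitive_radical r n).choose

lemma zetaRad_spec (r : ℚˣ) (n : ℕ+) : IsPrimitiveRoot (zetaRad r n : Qbarˣ) n :=
  (exists_primitive_radical r n).choose_spec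

lemma zetaRad_pow (r : ℚˣ) (n : ℕ+) : zetaRad r n ^ (n : ℕ) = 1 :=
  Subtype.ext (zetaRad_spec r n).pow_eq_one

lemma exists_eq_zetaRad_pow {n : ℕ+} {z : radicals r} (hz : z ^ (n : ℕ) = 1) :
    ∃ i : ℕ, z = zetaRad r n ^ i := by
  have hP : IsPrimitiveRoot ((zetaRad r n : Qbarˣ) : Qbar) n :=
    (zetaRad_spec r n).map_of_injective (f := Units.coeHom Qbar) Units.val_injective
  have hz' : ((z : Qbarˣ) : Qbar) ^ (n : ℕ) = 1 := by
    rw [← Units.val_pow_eq_pow_val, ← Subgroup.coe_pow, hz]; rfl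
  obtain ⟨i, -, hi⟩ := hP.eq_pow_of_pow_eq_one hz'
  exact ⟨i, Subtype.ext (Units.ext hi.symm)⟩

lemma exists_exponent (a : MulAut (radicals r)) (n : ℕ+) :
    ∃ k : ℕ, a (zetaRad r n) = zetaRad r n ^ k :=
  exists_eq_zetaRad_pow (by rw [← map_pow, zetaRad_pow, map_one])

/-- The class modulo `n` of the exponent through which `a` acts on the `n`-th roots of unity. -/
def cycloMod (a : MulAut (radicals r)) (n : ℕ+) : ZMod n := ((exists_exponent a n).choose : ℕ)

lemma apply_eq_pow {a : MulAut (radicals r)} {n : ℕ+} {k : ℕ} (hk : (k : ZMod n) = cycloMod a n)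
    {z : radicals r} (hz : z ^ (n : ℕ) = 1) : a z = z ^ k := by
  obtain ⟨i, rfl⟩ := exists_eq_zetaRad_pow hz
  have h1 : a (zetaRad r n) = zetaRad r n ^ k := by
    rw [(exists_exponent a n).choose_spec]
    apply Subtype.ext
    exact pow_eq_of_cast (zetaRad_spec r n).pow_eq_one hk.symm
  rw [map_pow, h1, ← pow_mul, ← pow_mul, mul_comm]

lemma cast_eq_of_zetaRad_pow {n : ℕ+} {k l : ℕ} (h : zetaRad r n ^ k = zetaRad r n ^ l) :
    (k : ZMod n) = l := by
  rw [ZMod.natCast_eq_natCast_iff]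
  have h' := pow_eq_pow_iff_modEq.1 (congrArg Subtype.val h : (zetaRad r n : Qbarˣ) ^ k = _ ^ l)
  rwa [← (zetaRad_spec r n).eq_orderOf] at h'

lemma cycloMod_eq {a : MulAut (radicals r)} {n : ℕ+} {k : ℕ}
    (h : a (zetaRad r n) = zetaRad r n ^ k) : cycloMod a n = k :=
  cast_eq_of_zetaRad_pow ((exists_exponent a n).choose_spec.symm.trans h)

/-- The cyclotomic character of an automorphism of the group of radicals, with values in `Ẑ`. -/
def cycloHom (r : ℚˣ) : MulAut (radicals r) →* ZHat where
  toFun a := ⟨fun n => cycloMod a n, by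
    intro m n hmn
    obtain ⟨k, hk⟩ := ZMod.natCast_zmod_surjective (cycloMod a n)
    change ZMod.castHom hmn (ZMod m) (cycloMod a n) = cycloMod a m
    rw [← hk, map_natCast]
    symm
    refine cycloMod_eq (apply_eq_pow hk ?_)
    obtain ⟨c, hc⟩ := hmn
    rw [hc, pow_mul, zetaRad_pow, one_pow]⟩
  map_one' := by
    apply Subtype.ext; funext n
    have : cycloMod (1 : MulAut (radicals r)) n = (1 : ℕ) := cycloMod_eq (by rw [pow_one]; rfl)
    rw [Nat.cast_one] at this
    exact this
  map_mul' a b := by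
    apply Subtype.ext; funext n
    obtain ⟨k, hk⟩ := ZMod.natCast_zmod_surjective (cycloMod a n)
    obtain ⟨l, hl⟩ := ZMod.natCast_zmod_surjective (cycloMod b n)
    change cycloMod (a * b) n = cycloMod a n * cycloMod b n
    rw [← hk, ← hl, ← Nat.cast_mul]
    refine cycloMod_eq ?_
    rw [MulAut.mul_apply, apply_eq_pow hl (zetaRad_pow r n), map_pow,
      apply_eq_pow hk (zetaRad_pow r n), pow_mul]

/-- The cyclotomic character, with values in `Ẑ*`. -/
def cycloChar (r : ℚˣ) : MulAut (radicals r) →* ZHatˣ := (cycloHom r).toHomUnits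

lemma apply_torsion (a : MulAut (radicals r)) {z : radicals r} {n : ℕ+} (hz : z ^ (n : ℕ) = 1) :
    a z = z ^ residue (cycloChar r a) n :=
  apply_eq_pow (residue_cast _ n) hz

/-- The system `a (r₀ ^ (1/n)) / r₀ ^ (1/n)` of roots of unity. -/
def kummerTate (hρ : IsRationalPower r₀ ρ) (h : IsRadicalGenerator r r₀) (a : radicalAut r) :
    TateModule :=
  ⟨fun n => ⟨((a : MulAut (radicals r)) ⟨_, hρ.rpow_mem h (1 / (n : ℚ))⟩ : radicals r) *
      (rpow ρ (1 / (n : ℚ)))⁻¹, by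
    rw [mem_rootsOfUnity]
    have hw : (⟨_, hρ.rpow_mem h (1 / (n : ℚ))⟩ : radicals r) ^ (n : ℕ)
        = ⟨ratUnits r₀, h.mem⟩ := Subtype.ext (hρ.rpow_inv_pow n)
    rw [mul_pow, ← Subgroup.coe_pow, ← map_pow, hw, inv_pow, hρ.rpow_inv_pow,
      a.2 ⟨ratUnits r₀, h.mem⟩ ⟨r₀, rfl⟩, mul_inv_cancel]⟩, by
    intro m n
    have hm : ((m : ℕ) : ℚ) ≠ 0 := by exact_mod_cast m.ne_zero
    have hw : rpow ρ (1 / ((m * n : ℕ+) : ℚ)) ^ (m : ℕ) = rpow ρ (1 / (n : ℚ)) := by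
      rw [← rpow_mul_nat]; congr 1; push_cast; field_simp
    have hw' : (⟨_, hρ.rpow_mem h (1 / ((m * n : ℕ+) : ℚ))⟩ : radicals r) ^ (m : ℕ)
        = ⟨_, hρ.rpow_mem h (1 / (n : ℚ))⟩ := Subtype.ext hw
    change (_ * _) ^ (m : ℕ) = _ * _
    rw [mul_pow, ← Subgroup.coe_pow, ← map_pow, hw', inv_pow, hw]⟩

lemma component_kummerTate (hρ : IsRationalPower r₀ ρ) (h : IsRadicalGenerator r r₀)
    (a : radicalAut r) (n : ℕ+) {y : radicals r} (hy : (y : Qbarˣ) = rpow ρ (1 / (n : ℚ))) :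
    component (kummerTate hρ h a) n =
      ((a : MulAut (radicals r)) y : radicals r) * (y : Qbarˣ)⁻¹ := by
  have : y = ⟨_, hρ.rpow_mem h (1 / (n : ℚ))⟩ := Subtype.ext hy
  rw [this]; rfl

/-- The isomorphism of the affine group with the group of automorphisms of the radicals. -/
def affEquiv (hρ : IsRationalPower r₀ ρ) (h : IsRadicalGenerator r r₀) :
    AffineGroup ≃* radicalAut r where
  toFun p := ⟨affAut hρ h p, affAut_mem hρ h p⟩
  invFun a := ⟨kummerTate hρ h a, cycloChar r a⟩
  left_inv p := by
    apply SemidirectProduct.ext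
    · apply tate_ext; intro n
      rw [component_kummerTate hρ h _ n (y := ⟨_, hρ.rpow_mem h _⟩) rfl]
      change (affHom hρ h p.left p.right _ : Qbarˣ) * _ = _
      rw [affHom_root hρ h p.left p.right (n := n) rfl, mul_inv_cancel_right]
    · apply Units.ext; apply Subtype.ext; funext n
      change cycloMod (affAut hρ h p) n = _
      rw [← residue_cast]
      exact cycloMod_eq (affHom_torsion hρ h p.left p.right (zetaRad_pow r n))
  right_inv a := by
    apply Subtype.ext
    have : affHom hρ h (kummerTate hρ h a) (cycloChar r a)
        = ((a : MulAut (radicals r)) : radicals r →* radicals r) := by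
      apply radicals_hom_ext hρ h
      · intro z n hz
        rw [affHom_torsion hρ h _ _ hz]
        exact (apply_torsion _ hz).symm
      · intro y n hy
        apply Subtype.ext
        rw [affHom_root hρ h _ _ hy, component_kummerTate hρ h a n hy, inv_mul_cancel_right]
        rfl
    ext1 y
    exact DFunLike.congr_fun this y
  map_mul' p q := by
    apply Subtype.ext
    ext1 y
    exact DFunLike.congr_fun (affHom_mul hρ h p q) y

/-! ### Topology -/

/-- Sets of automorphisms defined by the value at one radical are open. -/
lemma isOpen_apply_mem (y : radicals r) (S : Set (radicals r)) :
    IsOpen {a : radicalAut r | (a : MulAut (radicals r)) y ∈ S} := by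
  let _ : TopologicalSpace (radicals r) := ⊥
  have : DiscreteTopology (radicals r) := ⟨rfl⟩
  have h1 : Continuous fun (a : radicalAut r) (x : radicals r) => (a : MulAut (radicals r)) x :=
    continuous_induced_dom
  exact (isOpen_discrete S).preimage ((continuous_apply y).comp h1)

/-- A map on `A` that factors through the value at one radical is continuous. -/
lemma continuous_of_apply {X : Type*} [TopologicalSpace X] (f : radicalAut r → X) (y : radicals r)
    (hf : ∀ a b : radicalAut r,
      (a : MulAut (radicals r)) y = (b : MulAut (radicals r)) y → f a = f b) : Continuous f := by
  refine continuous_def.2 fun s _ => ?_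
  convert! isOpen_apply_mem y ((fun a : radicalAut r => (a : MulAut (radicals r)) y) '' (f ⁻¹' s))
  ext a
  constructor
  · exact fun ha => ⟨a, ha, rfl⟩
  · rintro ⟨b, hb, hab⟩
    change f a ∈ s
    rw [← hf b a hab]
    exact hb

lemma continuous_component {X : Type*} [TopologicalSpace X] (n : ℕ+) (f : Qbarˣ → X) :
    Continuous fun x : TateModule => f (component x n) := by
  let _ : ∀ n : ℕ+, TopologicalSpace (rootsOfUnity n Qbar) := fun _ => ⊥
  have : ∀ n : ℕ+, DiscreteTopology (rootsOfUnity n Qbar) := fun _ => ⟨rfl⟩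
  have h1 : Continuous fun x : TateModule => (x : ∀ n : ℕ+, rootsOfUnity n Qbar) :=
    continuous_induced_dom
  exact (continuous_of_discreteTopology (f := fun z : rootsOfUnity n Qbar => f z)).comp
    ((continuous_apply n).comp h1)

lemma continuous_residue (n : ℕ+) : Continuous fun u : ZHatˣ => residue u n := by
  have h1 : Continuous fun u : ZHatˣ => ((u : ZHat) : ∀ n : ℕ+, ZMod n) n :=
    (continuous_apply n).comp (continuous_subtype_val.comp Units.continuous_val)
  exact (continuous_of_discreteTopology (f := ZMod.val)).comp h1

lemma continuous_affine : Continuous fun p : AffineGroup => (p.left, p.right) :=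
  continuous_induced_dom

lemma continuous_affEquiv (hρ : IsRationalPower r₀ ρ) (h : IsRadicalGenerator r r₀) :
    Continuous (affEquiv hρ h) := by
  let _ : TopologicalSpace (radicals r) := ⊥
  have : DiscreteTopology (radicals r) := ⟨rfl⟩
  refine continuous_induced_rng.2 (continuous_pi fun y => ?_)
  obtain ⟨z, w, k, n, m, hz, hw, rfl⟩ := exists_eq_mul_zpow hρ h y
  let _ : TopologicalSpace Qbarˣ := ⊥
  have : DiscreteTopology Qbarˣ := ⟨rfl⟩
  have h1 : Continuous fun p : AffineGroup => (component p.left n, residue p.right k) :=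
    (((continuous_component n id).comp continuous_fst).prodMk
      ((continuous_residue k).comp continuous_snd)).comp continuous_affine
  have h2 : Continuous fun p : AffineGroup =>
      (z : Qbarˣ) ^ residue p.right k * (component p.left n * w) ^ m :=
    (continuous_of_discreteTopology
      (f := fun t : Qbarˣ × ℕ => (z : Qbarˣ) ^ t.2 * (t.1 * w) ^ m)).comp h1
  have h3 : ∀ p : AffineGroup, ((affEquiv hρ h p : MulAut (radicals r)) (z * w ^ m) : Qbarˣ)
      = (z : Qbarˣ) ^ residue p.right k * (component p.left n * w) ^ m := by
    intro p
    change (affHom hρ h p.left p.right (z * w ^ m) : Qbarˣ) = _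
    rw [map_mul, map_zpow, affHom_torsion hρ h _ _ hz, Subgroup.coe_mul, Subgroup.coe_zpow,
      affHom_root hρ h _ _ hw, Subgroup.coe_pow]
  refine continuous_discrete_rng.2 fun b => ?_
  have h4 := (continuous_discrete_rng.1 h2) (b : Qbarˣ)
  convert! h4
  ext p
  simp only [Set.mem_preimage, Set.mem_singleton_iff, Function.comp_apply, ← h3, Subtype.ext_iff]

lemma continuous_affEquiv_symm (hρ : IsRationalPower r₀ ρ) (h : IsRadicalGenerator r r₀) :
    Continuous (affEquiv hρ h).symm := by
  refine continuous_induced_rng.2 (Continuous.prodMk ?_ ?_)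
  · let _ : ∀ n : ℕ+, TopologicalSpace (rootsOfUnity n Qbar) := fun _ => ⊥
    refine continuous_induced_rng.2 (continuous_pi fun n => ?_)
    refine continuous_of_apply _ ⟨_, hρ.rpow_mem h (1 / (n : ℚ))⟩ fun a b hab => ?_
    apply Subtype.ext
    change component (kummerTate hρ h a) n = component (kummerTate hρ h b) n
    rw [component_kummerTate hρ h a n (y := ⟨_, hρ.rpow_mem h _⟩) rfl,
      component_kummerTate hρ h b n (y := ⟨_, hρ.rpow_mem h _⟩) rfl, hab]
  · have key : ∀ (n : ℕ+) (a b : radicalAut r),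
        (a : MulAut (radicals r)) (zetaRad r n) = (b : MulAut (radicals r)) (zetaRad r n) →
        cycloMod (a : MulAut (radicals r)) n = cycloMod (b : MulAut (radicals r)) n := by
      intro n a b hab
      obtain ⟨k, hk⟩ := exists_exponent (a : MulAut (radicals r)) n
      rw [cycloMod_eq hk, cycloMod_eq (hab ▸ hk)]
    refine Units.continuous_iff.2 ⟨?_, ?_⟩
    · refine Continuous.subtype_mk (continuous_pi fun n => ?_) _
      exact continuous_of_apply _ (zetaRad r n) (key n)
    · have : (fun a : radicalAut r => ((((affEquiv hρ h).symm a).right⁻¹ : ZHatˣ) : ZHat))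
          = fun a : radicalAut r => cycloHom r ((a⁻¹ : radicalAut r) : MulAut (radicals r)) := by
        funext a
        change (((cycloChar r a)⁻¹ : ZHatˣ) : ZHat) = cycloChar r ((a : MulAut (radicals r))⁻¹)
        rw [map_inv]
      change Continuous (fun a : radicalAut r =>
        ((((affEquiv hρ h).symm a).right⁻¹ : ZHatˣ) : ZHat))
      rw [this]
      refine Continuous.subtype_mk (continuous_pi fun n => ?_) _
      refine continuous_of_apply _ (zetaRad r n) fun a b hab => ?_
      refine key n _ _ ?_
      -- `b⁻¹` permutes the `n`-th roots of unity, which are powers of the chosen one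
      have hpow : ((b : MulAut (radicals r))⁻¹ (zetaRad r n)) ^ (n : ℕ) = 1 := by
        rw [← map_pow, zetaRad_pow, map_one]
      obtain ⟨i, hi⟩ := exists_eq_zetaRad_pow hpow
      have h1 : (a : MulAut (radicals r)) (zetaRad r n ^ i) = zetaRad r n := by
        rw [map_pow, hab, ← map_pow, ← hi]
        exact MulAut.apply_inv_self _ _ _
      change (a : MulAut (radicals r))⁻¹ (zetaRad r n) = (b : MulAut (radicals r))⁻¹ (zetaRad r n)
      rw [hi]
      conv_lhs => rw [← h1]
      exact MulAut.inv_apply_self _ _ _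

/-- The isomorphism of topological groups between the affine group and `A`. -/
def affHomeo (hρ : IsRationalPower r₀ ρ) (h : IsRadicalGenerator r r₀) :
    AffineGroup ≃ₜ* radicalAut r :=
  { affEquiv hρ h with
    continuous_toFun := continuous_affEquiv hρ h
    continuous_invFun := continuous_affEquiv_symm hρ h }

lemma affHomeo_torsion (hρ : IsRationalPower r₀ ρ) (h : IsRadicalGenerator r r₀) (x : TateModule)
    (u : ZHatˣ) (n : ℕ+) (z : radicals r) (hz : z ^ (n : ℕ) = 1) :
    (affHomeo hρ h ⟨x, u⟩ : MulAut (radicals r)) z = z ^ residue u n :=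
  affHom_torsion hρ h x u hz

lemma affHomeo_root (hρ : IsRationalPower r₀ ρ) (h : IsRadicalGenerator r r₀) (x : TateModule)
    (u : ZHatˣ) (n : ℕ+) (y : radicals r) (hy : (y : Qbarˣ) = rpow ρ (1 / (n : ℚ))) :
    (((affHomeo hρ h ⟨x, u⟩ : MulAut (radicals r)) y : radicals r) : Qbarˣ) = component x n * y :=
  affHom_root hρ h x u hy

end Inverse

/-! ### Radicals with commuting conjugates -/

section Abelian

variable {r r₀ : ℚˣ} {ρ : Multiplicative ℚ →* Qbarˣ}

/-- The action of a field automorphism on units. -/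
def unitAct (σ : Qbar ≃ₐ[ℚ] Qbar) : Qbarˣ →* Qbarˣ := Units.map (σ : Qbar →* Qbar)

lemma unitAct_val (σ : Qbar ≃ₐ[ℚ] Qbar) (x : Qbarˣ) : (unitAct σ x : Qbar) = σ x := rfl

lemma unitAct_mul (σ τ : Qbar ≃ₐ[ℚ] Qbar) (x : Qbarˣ) :
    unitAct (σ * τ) x = unitAct σ (unitAct τ x) := rfl

lemma unitAct_inv_apply (σ : Qbar ≃ₐ[ℚ] Qbar) (x : Qbarˣ) : unitAct σ⁻¹ (unitAct σ x) = x := by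
  rw [← unitAct_mul, inv_mul_cancel]; rfl

lemma unitAct_apply_inv (σ : Qbar ≃ₐ[ℚ] Qbar) (x : Qbarˣ) : unitAct σ (unitAct σ⁻¹ x) = x := by
  rw [← unitAct_mul, mul_inv_cancel]; rfl

lemma unitAct_rat (σ : Qbar ≃ₐ[ℚ] Qbar) (q : ℚˣ) : unitAct σ (ratUnits q) = ratUnits q :=
  Units.ext (σ.commutes q)

lemma ActsOnRoots.unit {σ : Qbar ≃ₐ[ℚ] Qbar} {k n : ℕ} (h : ActsOnRoots σ k n) {z : Qbarˣ}
    (hz : z ^ k = 1) : unitAct σ z = z ^ n :=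
  Units.ext (by
    rw [unitAct_val, Units.val_pow_eq_pow_val]
    exact h z (by rw [← Units.val_pow_eq_pow_val, hz, Units.val_one]))

/-- Irreducibility of the cyclotomic polynomials: every class prime to `n` is realized. -/
lemma exists_actsOnRoots {n k : ℕ} (hn : n ≠ 0) (hk : k.Coprime n) :
    ∃ σ : Qbar ≃ₐ[ℚ] Qbar, ActsOnRoots σ n k := by
  obtain ⟨z, hz⟩ := exists_primitive n hn
  have hpos := Nat.pos_of_ne_zero hn
  have hmin : ∀ y : Qbar, IsPrimitiveRoot y n → minpoly ℚ y = Polynomial.cyclotomic n ℚ := by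
    intro y hy
    rw [Polynomial.cyclotomic_eq_minpoly_rat hy hpos,
      Subsingleton.elim (DivisionRing.toRatAlgebra : Algebra ℚ Qbar)
        (AlgebraicClosure.instAlgebra ℚ)]
  have hconj : IsConjRoot ℚ (z ^ k) z := by
    rw [isConjRoot_def, hmin z hz, hmin _ (hz.pow_of_coprime k hk)]
  obtain ⟨σ, hσ⟩ := hconj.exists_algEquiv
  refine ⟨σ, fun y hy => ?_⟩
  have : NeZero n := ⟨hn⟩
  obtain ⟨i, -, rfl⟩ := hz.eq_pow_of_pow_eq_one hy
  rw [map_pow, hσ, ← pow_mul, ← pow_mul, mul_comm]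

lemma exists_rat_of_fixed {x : Qbarˣ} (h : ∀ σ, unitAct σ x = x) : ∃ q : ℚˣ, ratUnits q = x := by
  have h1 : (x : Qbar) ∈ Set.range (algebraMap ℚ Qbar) :=
    (InfiniteGalois.mem_range_algebraMap_iff_fixed _).2 fun σ => congrArg Units.val (h σ)
  obtain ⟨q, hq⟩ := h1
  have hq0 : q ≠ 0 := by
    rintro rfl
    exact x.ne_zero (by rw [← hq, map_zero])
  exact ⟨Units.mk0 q hq0, Units.ext hq⟩

/-- If the Galois group acts on the conjugates of `x = r₀ ^ a` through an abelian quotient, compare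
an arbitrary `σ` with a `τ` that inverts the roots of unity of order dividing the denominator of
`a`: with `τ x = t x`, the element `t x ^ 2` is fixed by `σ`, hence rational. As `r₀` generates
`R_∞ ∩ ℚ*` up to sign, this forces `2 a` to be an integer. -/
lemma IsRationalPower.exists_eq_half (hρ : IsRationalPower r₀ ρ) (h : IsRadicalGenerator r r₀)
    {a : ℚ} (hcomm : ∀ σ τ, unitAct σ (unitAct τ (rpow ρ a)) = unitAct τ (unitAct σ (rpow ρ a))) :
    ∃ m : ℤ, a = m / 2 := by
  set x := rpow ρ a with hx
  set N := a.den with hN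
  have hN0 : N ≠ 0 := a.den_ne_zero
  have hxN : x ^ N = ratUnits (r₀ ^ a.num) := by
    rw [hx, ← rpow_mul_nat, hN, Rat.mul_den_eq_num, hρ.rpow_int]
  have hroot : ∀ σ, (unitAct σ x * x⁻¹) ^ N = 1 := by
    intro σ
    rw [mul_pow, inv_pow, ← map_pow, hxN, unitAct_rat, mul_inv_cancel]
  obtain ⟨τ, hτ⟩ := exists_actsOnRoots (n := N) (k := N - 1) hN0 (by
    rw [Nat.coprime_self_sub_left (Nat.one_le_iff_ne_zero.2 hN0)]; exact Nat.coprime_one_left N)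
  have hτinv : ∀ z : Qbarˣ, z ^ N = 1 → unitAct τ z * z = 1 := by
    intro z hz
    rw [hτ.unit hz, ← pow_succ, Nat.sub_add_cancel (Nat.one_le_iff_ne_zero.2 hN0), hz]
  obtain ⟨t, ht⟩ : ∃ t, t = unitAct τ x * x⁻¹ := ⟨_, rfl⟩
  have htx : unitAct τ x = t * x := by rw [ht, inv_mul_cancel_right]
  obtain ⟨q, hq⟩ := exists_rat_of_fixed (x := t * x ^ 2) (by
    intro σ
    obtain ⟨s, hs⟩ : ∃ s, s = unitAct σ x * x⁻¹ := ⟨_, rfl⟩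
    have hsx : unitAct σ x = s * x := by rw [hs, inv_mul_cancel_right]
    have h1 := hcomm σ τ
    rw [htx, hsx, map_mul, map_mul, hsx, htx] at h1
    have h2 := hτinv s (hs ▸ hroot σ)
    have h3 : unitAct σ t * s ^ 2 = t := by
      have h4 : unitAct σ t * s = unitAct τ s * t := by
        apply mul_right_cancel (b := x)
        rw [mul_assoc, h1, mul_assoc]
      rw [sq, ← mul_assoc, h4, mul_right_comm, h2, one_mul]
    rw [map_mul, map_pow, hsx, mul_pow, ← mul_assoc, h3])
  have hqN : q ^ N = r₀ ^ (2 * a.num) := by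
    apply ratUnits_injective
    rw [map_pow, hq, mul_pow, ht, hroot τ, one_mul, ← pow_mul, mul_comm, pow_mul, hxN, ← map_pow,
      mul_comm, zpow_mul, zpow_ofNat]
  obtain ⟨m, hm⟩ := h.eq_or_eq_neg (mem_ratRadicals_of_pow_mem (q := q) (Nat.pos_of_ne_zero hN0)
    (hqN ▸ zpow_mem h.mem _))
  have hq2 : q ^ 2 = r₀ ^ (2 * m) := by
    rw [mul_comm, zpow_mul, zpow_ofNat]
    rcases hm with hm | hm <;> rw [hm]
    rw [neg_sq]
  have h5 : r₀ ^ (2 * (2 * a.num) - 2 * m * N) = 1 := by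
    rw [zpow_sub, mul_comm 2 (2 * a.num), zpow_mul, ← hqN, zpow_mul, ← hq2, zpow_natCast,
      zpow_ofNat, ← pow_mul, ← pow_mul, mul_comm N, mul_inv_cancel]
  have h6 : 2 * (2 * a.num) - 2 * m * N = 0 := by
    have h7 : rpow ρ ((2 * (2 * a.num) - 2 * m * N : ℤ) : ℚ) ^ 1 = 1 := by
      rw [hρ.rpow_int, h5, map_one, pow_one]
    exact_mod_cast hρ.eq_zero_of_pow one_ne_zero h7
  refine ⟨m, ?_⟩
  have hNq : (N : ℚ) ≠ 0 := by exact_mod_cast hN0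
  have h8 : 2 * (2 * (a.num : ℚ)) - 2 * m * N = 0 := by exact_mod_cast h6
  rw [← Rat.num_div_den a, ← hN]
  field_simp
  linarith

/-! ### The maximal abelian extension -/

lemma commute_of_mem_Qab {x : Qbar} (hx : x ∈ Qab) (σ τ : Qbar ≃ₐ[ℚ] Qbar) :
    σ (τ x) = τ (σ x) := by
  set g : Gal(Qbar/ℚ) := (τ * σ)⁻¹ * (σ * τ) with hg
  have hle : Qab ≤ IntermediateField.fixedField (Subgroup.zpowers g) := by
    refine iSup_le fun E => ?_
    have hE := E.2
    rw [IntermediateField.le_iff_le, Subgroup.zpowers_le, ← IntermediateField.restrictNormalHom_ker,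
      MonoidHom.mem_ker, hg, map_mul, map_inv, map_mul, map_mul, inv_mul_eq_one]
    exact hE.toIsMulCommutative.is_comm.comm _ _
  have h1 := (IntermediateField.mem_fixedField_iff _ _).1 (hle hx) g (Subgroup.mem_zpowers g)
  have h2 : (τ * σ) (g x) = (τ * σ) x := by rw [h1]
  rw [hg, ← AlgEquiv.mul_apply, mul_inv_cancel_left] at h2
  exact h2

lemma IsRationalPower.half_sq (hρ : IsRationalPower r₀ ρ) :
    (rpow ρ (1 / 2) : Qbar) ^ 2 = algebraMap ℚ Qbar r₀ := by
  have := congrArg Units.val (hρ.rpow_inv_pow 2)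
  exact this

lemma IsRationalPower.map_half (hρ : IsRationalPower r₀ ρ) (σ : Qbar →ₐ[ℚ] Qbar) :
    σ (rpow ρ (1 / 2)) = rpow ρ (1 / 2) ∨ σ (rpow ρ (1 / 2)) = -(rpow ρ (1 / 2) : Qbar) := by
  apply sq_eq_sq_iff_eq_or_eq_neg.1
  rw [← map_pow, hρ.half_sq, AlgHom.commutes]

lemma IsRationalPower.isAbelianGalois_quadField (hρ : IsRationalPower r₀ ρ) :
    IsAbelianGalois ℚ (quadField ρ) := by
  have hnormal : Normal ℚ (quadField ρ) := by
    rw [IntermediateField.normal_iff_forall_map_le]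
    intro σ
    rw [quadField, IntermediateField.adjoin_map, Set.image_singleton,
      IntermediateField.adjoin_simple_le_iff]
    have hmem := IntermediateField.mem_adjoin_simple_self ℚ (rpow ρ (1 / 2) : Qbar)
    rcases hρ.map_half σ with h | h <;> rw [h]
    · exact hmem
    · exact neg_mem hmem
  have hgal : IsGalois ℚ (quadField ρ) :=
    { to_isSeparable := Algebra.IsAlgebraic.isSeparable_of_perfectField
      to_normal := hnormal }
  refine { hgal with is_comm := ⟨fun f g => ?_⟩ }
  set s : quadField ρ := ⟨rpow ρ (1 / 2), IntermediateField.mem_adjoin_simple_self ℚ _⟩ with hs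
  have hsq : s ^ 2 = algebraMap ℚ (quadField ρ) r₀ := Subtype.ext hρ.half_sq
  have hact : ∀ f : quadField ρ ≃ₐ[ℚ] quadField ρ, f s = s ∨ f s = -s := by
    intro f
    apply sq_eq_sq_iff_eq_or_eq_neg.1
    rw [← map_pow, hsq, AlgEquiv.commutes]
  have hext : ((f * g : quadField ρ ≃ₐ[ℚ] quadField ρ) : quadField ρ →ₐ[ℚ] quadField ρ)
      = (g * f : quadField ρ ≃ₐ[ℚ] quadField ρ) := by
    refine IntermediateField.adjoin_algHom_ext ℚ fun x hx => ?_
    rw [Set.mem_singleton_iff] at hx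
    subst hx
    change f (g s) = g (f s)
    rcases hact f with h | h <;> rcases hact g with h' | h' <;> simp [h, h']
  ext1 x
  exact DFunLike.congr_fun hext x

/-- The rational powers of `r₀` in the maximal abelian extension of `ℚ`. -/
theorem IsRationalPower.range_inf_QabUnits (hρ : IsRationalPower r₀ ρ)
    (h : IsRadicalGenerator r r₀) :
    ρ.range ⊓ QabUnits = Subgroup.zpowers (rpow ρ (1 / 2)) := by
  apply le_antisymm
  · rintro _ ⟨⟨a, rfl⟩, ha⟩
    obtain ⟨m, hm⟩ := hρ.exists_eq_half h (a := a.toAdd) fun σ τ =>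
      Units.ext (commute_of_mem_Qab ha σ τ)
    refine ⟨m, ?_⟩
    change rpow ρ (1 / 2) ^ m = rpow ρ a.toAdd
    rw [← rpow_mul_int, hm]
    congr 1; ring
  · rw [Subgroup.zpowers_le]
    refine ⟨⟨_, rfl⟩, ?_⟩
    have hle : quadField ρ ≤ Qab :=
      le_iSup (fun E : {E : IntermediateField ℚ Qbar // IsAbelianGalois ℚ E} => E.1)
        ⟨quadField ρ, hρ.isAbelianGalois_quadField⟩
    exact hle (IntermediateField.mem_adjoin_simple_self ℚ _)

/-! ### Kummer theory over the cyclotomic fields -/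

/-- The values `τ α / α` at `α = r₀ ^ (1/M)` of the automorphisms `τ` fixing the `M`-th roots of
unity. -/
def kummerGroup (ρ : Multiplicative ℚ →* Qbarˣ) (M : ℕ+) : Subgroup Qbarˣ where
  carrier := {w | w ^ (M : ℕ) = 1 ∧ ∃ τ, ActsOnRoots τ M 1 ∧
    unitAct τ (rpow ρ (1 / (M : ℚ))) = w * rpow ρ (1 / (M : ℚ))}
  one_mem' := ⟨one_pow _, 1, fun z _ => (pow_one z).symm, by rw [one_mul]; rfl⟩
  mul_mem' := by
    rintro v w ⟨hv, σ, hσ, hσv⟩ ⟨hw, τ, hτ, hτw⟩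
    refine ⟨by rw [mul_pow, hv, hw, one_mul], σ * τ, fun z hz => ?_, ?_⟩
    · rw [AlgEquiv.mul_apply, hτ z hz, pow_one, hσ z hz, pow_one]
    · rw [unitAct_mul, hτw, map_mul, hσv, hσ.unit hw, pow_one, mul_left_comm, mul_assoc]
  inv_mem' := by
    rintro w ⟨hw, τ, hτ, hτw⟩
    refine ⟨by rw [inv_pow, hw, inv_one], τ⁻¹, fun z hz => ?_, ?_⟩
    · have : τ z = z := by rw [hτ z hz, pow_one]
      conv_lhs => rw [← this]
      rw [pow_one, ← AlgEquiv.mul_apply, inv_mul_cancel, AlgEquiv.one_apply]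
    · rw [eq_inv_mul_iff_mul_eq]
      have h1 : unitAct τ⁻¹ w = w := by
        have h2 : unitAct τ w = w := by rw [hτ.unit hw, pow_one]
        conv_lhs => rw [← h2]
        exact unitAct_inv_apply τ w
      conv_lhs => rw [← h1]
      rw [← map_mul, ← hτw, unitAct_inv_apply]

/-- If the group of Kummer values has order `k`, then `r₀ ^ (k/M)` is fixed by all automorphisms
fixing the `M`-th roots of unity, in particular by commutators, so that `2 k / M` is an integer. -/
lemma mem_kummerGroup (hρ : IsRationalPower r₀ ρ) (h : IsRadicalGenerator r r₀) {M : ℕ+} {L : ℕ}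
    (hM : (M : ℕ) = 2 * L) {w : Qbarˣ} (hw : w ^ L = 1) : w ∈ kummerGroup ρ M := by
  set H := kummerGroup ρ M with hH
  set α := rpow ρ (1 / (M : ℚ)) with hα
  have hle : H ≤ rootsOfUnity M Qbar := fun v hv => (mem_rootsOfUnity _ _).2 hv.1
  have : Finite H := Finite.of_injective _ (Subgroup.inclusion_injective hle)
  set k := Nat.card H with hk
  have hk0 : k ≠ 0 := Nat.card_pos.ne'
  have hfix : ∀ τ, ActsOnRoots τ M 1 → unitAct τ (α ^ k) = α ^ k := by
    intro τ hτ
    have hmem : unitAct τ α * α⁻¹ ∈ H := by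
      refine ⟨?_, τ, hτ, by rw [inv_mul_cancel_right]⟩
      rw [mul_pow, inv_pow, ← map_pow, hα, hρ.rpow_inv_pow, unitAct_rat, mul_inv_cancel]
    have h1 : (unitAct τ α * α⁻¹) ^ k = 1 :=
      congrArg Subtype.val (pow_card_eq_one' (x := (⟨_, hmem⟩ : H)))
    rwa [mul_pow, inv_pow, mul_inv_eq_one, ← map_pow] at h1
  have hpow : ∀ σ : Qbar ≃ₐ[ℚ] Qbar, ∃ i, ActsOnRoots σ M i := by
    intro σ
    have : NeZero (M : ℕ) := ⟨M.ne_zero⟩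
    obtain ⟨z, hz⟩ := exists_primitive M M.ne_zero
    obtain ⟨i, -, hi⟩ := hz.eq_pow_of_pow_eq_one (ξ := σ z) (by
      rw [← map_pow, hz.pow_eq_one, map_one])
    refine ⟨i, fun y hy => ?_⟩
    obtain ⟨j, -, rfl⟩ := hz.eq_pow_of_pow_eq_one hy
    rw [map_pow, ← hi, ← pow_mul, ← pow_mul, mul_comm]
  have hcomm : ∀ σ τ, unitAct σ (unitAct τ (α ^ k)) = unitAct τ (unitAct σ (α ^ k)) := by
    intro σ τ
    have h1 : ActsOnRoots ((τ * σ)⁻¹ * (σ * τ)) M 1 := by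
      intro z hz
      obtain ⟨i, hi⟩ := hpow σ
      obtain ⟨j, hj⟩ := hpow τ
      have h2 : (σ * τ) z = (τ * σ) z := by
        rw [AlgEquiv.mul_apply, AlgEquiv.mul_apply, hj z hz, hi z hz, map_pow, map_pow, hi z hz,
          hj z hz, ← pow_mul, ← pow_mul, mul_comm]
      rw [AlgEquiv.mul_apply, h2, ← AlgEquiv.mul_apply, inv_mul_cancel, pow_one,
        AlgEquiv.one_apply]
    have h2 := congrArg (unitAct (τ * σ)) (hfix _ h1)
    rw [← unitAct_mul, mul_inv_cancel_left] at h2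
    exact h2
  have hαk : α ^ k = rpow ρ (1 / (M : ℚ) * k) := (rpow_mul_nat _ _).symm
  rw [hαk] at hcomm
  obtain ⟨m, hm⟩ := hρ.exists_eq_half h hcomm
  have hL0 : (L : ℚ) ≠ 0 := by
    have := M.ne_zero
    have : L ≠ 0 := by rintro rfl; omega
    exact_mod_cast this
  have hkL : (k : ℤ) = m * L := by
    have hMq : ((M : ℕ) : ℚ) = 2 * L := by exact_mod_cast hM
    rw [hMq] at hm
    field_simp at hm
    have : (k : ℚ) = m * L := by linarith
    exact_mod_cast this
  have hdvd : L ∣ k := by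
    rw [← Int.natCast_dvd_natCast, hkL]; exact dvd_mul_left _ _
  have hwk : w ^ k = 1 := by
    obtain ⟨c, hc⟩ := hdvd
    rw [hc, pow_mul, hw, one_pow]
  -- a subgroup of order `k` of the multiplicative group of a field is the group of `k`-th roots
  -- of unity
  have : NeZero k := ⟨hk0⟩
  have hHk : H ≤ rootsOfUnity k Qbar := fun v hv => by
    rw [mem_rootsOfUnity]
    exact congrArg Subtype.val (pow_card_eq_one' (x := (⟨v, hv⟩ : H)))
  have hEq : H = rootsOfUnity k Qbar := by
    refine Subgroup.eq_of_le_of_card_ge hHk ?_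
    exact card_rootsOfUnity Qbar k
  rw [hEq, mem_rootsOfUnity]
  exact hwk

end Abelian

section Characters

variable {r r₀ : ℚˣ} {ρ : Multiplicative ℚ →* Qbarˣ}

/-! ### The two quadratic characters -/

lemma exists_sign (hρ : IsRationalPower r₀ ρ) (h : IsRadicalGenerator r r₀) (a : radicalAut r) :
    ∃ ε : ℤˣ, ∀ y : radicals r, (y : Qbarˣ) = rpow ρ (1 / 2) →
      ((((a : MulAut (radicals r)) y : radicals r) : Qbarˣ) : Qbar)
        = ((ε : ℤ) : Qbar) * ((y : Qbarˣ) : Qbar) := by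
  let w : radicals r := ⟨_, hρ.rpow_mem h (1 / 2)⟩
  have hw : ∀ y : radicals r, (y : Qbarˣ) = rpow ρ (1 / 2) → y = w := fun y hy => Subtype.ext hy
  have hw2 : w ^ 2 = ⟨ratUnits r₀, h.mem⟩ := Subtype.ext (hρ.rpow_inv_pow 2)
  have hsq : (((a : MulAut (radicals r)) w : Qbarˣ) : Qbar) ^ 2 = ((w : Qbarˣ) : Qbar) ^ 2 := by
    rw [← Units.val_pow_eq_pow_val, ← Units.val_pow_eq_pow_val, ← Subgroup.coe_pow,
      ← Subgroup.coe_pow, ← map_pow, hw2, a.2 ⟨ratUnits r₀, h.mem⟩ ⟨r₀, rfl⟩]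
  rcases sq_eq_sq_iff_eq_or_eq_neg.1 hsq with h1 | h1
  · exact ⟨1, fun y hy => by rw [hw y hy, h1]; simp⟩
  · exact ⟨-1, fun y hy => by rw [hw y hy, h1]; simp⟩

lemma intUnits_eq_of_cast_mul {ε δ : ℤˣ} {y : Qbarˣ}
    (h : ((ε : ℤ) : Qbar) * (y : Qbar) = ((δ : ℤ) : Qbar) * (y : Qbar)) : ε = δ := by
  have := mul_right_cancel₀ y.ne_zero h
  exact Units.ext (by exact_mod_cast this)

/-- The character `ψ_K`, giving the action on `√r₀`. -/
def psiChar (hρ : IsRationalPower r₀ ρ) (h : IsRadicalGenerator r r₀) : radicalAut r →* ℤˣ :=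
  MonoidHom.mk' (fun a => (exists_sign hρ h a).choose) (by
    intro a b
    let w : radicals r := ⟨_, hρ.rpow_mem h (1 / 2)⟩
    have hab := (exists_sign hρ h (a * b)).choose_spec w rfl
    have ha := (exists_sign hρ h a).choose_spec w rfl
    have hb := (exists_sign hρ h b).choose_spec w rfl
    generalize (exists_sign hρ h (a * b)).choose = εab at *
    generalize (exists_sign hρ h a).choose = εa at *
    generalize (exists_sign hρ h b).choose = εb at *
    apply intUnits_eq_of_cast_mul (y := w)
    rw [← hab]
    change (((a : MulAut (radicals r)) ((b : MulAut (radicals r)) w) : Qbarˣ) : Qbar) = _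
    let e : radicals r := ⟨-1, mem_radicals_of_pow_eq_one two_ne_zero (by simp)⟩
    have he : (a : MulAut (radicals r)) e = e := a.2 e ⟨-1, by ext; simp [ratUnits, e]⟩
    rcases Int.units_eq_one_or εb with rfl | rfl
    · have hbw : (b : MulAut (radicals r)) w = w := Subtype.ext (Units.ext (by simpa using hb))
      rw [hbw, ha, mul_one]
    · have hbw : (b : MulAut (radicals r)) w = e * w :=
        Subtype.ext (Units.ext (by simpa [e] using hb))
      rw [hbw, map_mul, he, Subgroup.coe_mul, Units.val_mul, ha]
      simp [e])

lemma psiChar_spec (hρ : IsRationalPower r₀ ρ) (h : IsRadicalGenerator r r₀) (a : radicalAut r)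
    (y : radicals r) (hy : (y : Qbarˣ) = rpow ρ (1 / 2)) :
    ((((a : MulAut (radicals r)) y : radicals r) : Qbarˣ) : Qbar)
      = ((psiChar hρ h a : ℤ) : Qbar) * ((y : Qbarˣ) : Qbar) :=
  (exists_sign hρ h a).choose_spec y hy

lemma psiChar_affHomeo (hρ : IsRationalPower r₀ ρ) (h : IsRadicalGenerator r r₀) (x : TateModule)
    (u : ZHatˣ) :
    (((psiChar hρ h (affHomeo hρ h ⟨x, u⟩) : ℤˣ) : ℤ) : Qbar) = (component x 2 : Qbar) := by
  let w : radicals r := ⟨_, hρ.rpow_mem h (1 / 2)⟩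
  have h1 := psiChar_spec hρ h (affHomeo hρ h ⟨x, u⟩) w rfl
  rw [affHomeo_root hρ h x u 2 w rfl, Units.val_mul] at h1
  exact (mul_right_cancel₀ (w : Qbarˣ).ne_zero h1).symm

lemma jacobiSym_eq_of_modEq {d : ℤ} {m n : ℕ} (hm : Odd m) (hn : Odd n)
    (h : m ≡ n [MOD 4 * d.natAbs]) : jacobiSym d m = jacobiSym d n := by
  rw [jacobiSym.mod_right d hm, jacobiSym.mod_right d hn, h]

lemma odd_residue (u : ZHatˣ) (n : ℕ+) : Odd (residue u (4 * n)) := by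
  have h1 := residue_coprime u (4 * n)
  have h2 : 2 ∣ ((4 * n : ℕ+) : ℕ) := by
    rw [PNat.mul_coe]
    exact (by norm_num : 2 ∣ ((4 : ℕ+) : ℕ)).mul_right _
  exact Nat.coprime_two_right.1 (Nat.Coprime.coprime_dvd_right h2 h1)

/-- The character `u ↦ (d / u)` of `Ẑ*` for a non-zero integer `d`. -/
def jacobiChar (d : ℤ) (n : ℕ+) (hn : (n : ℕ) = d.natAbs) : ZHatˣ →* ℤˣ :=
  MonoidHom.toHomUnits
    { toFun := fun u => jacobiSym d (residue u (4 * n))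
      map_one' := by
        rw [← jacobiSym.one_right d]
        refine jacobiSym_eq_of_modEq (odd_residue 1 n) odd_one ?_
        rw [← hn]
        exact (ZMod.natCast_eq_natCast_iff _ _ _).1 (residue_one (4 * n))
      map_mul' := fun u v => by
        have : NeZero (residue u (4 * n)) := ⟨(odd_residue u n).pos.ne'⟩
        have : NeZero (residue v (4 * n)) := ⟨(odd_residue v n).pos.ne'⟩
        rw [← jacobiSym.mul_right]
        refine jacobiSym_eq_of_modEq (odd_residue _ n) ((odd_residue u n).mul (odd_residue v n)) ?_
        rw [← hn]
        exact (ZMod.natCast_eq_natCast_iff _ _ _).1 (residue_mul u v (4 * n)) }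

lemma jacobiChar_apply (d : ℤ) (n : ℕ+) (hn : (n : ℕ) = d.natAbs) (u : ZHatˣ) :
    ((jacobiChar d n hn u : ℤˣ) : ℤ) = jacobiSym d (residue u (4 * n)) := rfl

lemma residue_mod (u : ZHatˣ) {m n : ℕ+} (h : (m : ℕ) ∣ n) :
    residue u n % m = residue u m := by
  have h1 : residue u n % m = residue u m % m :=
    (ZMod.natCast_eq_natCast_iff _ _ _).1 (residue_cast_of_dvd u h)
  exact h1.trans (Nat.mod_eq_of_lt (ZMod.val_lt _))

/-- For a discriminant `d`, the character `u ↦ (d / u)` has period `|d|`. -/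
lemma jacobiChar_eq_kroneckerSymbol {d : ℤ} (hd : d % 4 = 0 ∨ d % 4 = 1) (n : ℕ+)
    (hn : (n : ℕ) = d.natAbs) (u : ZHatˣ) :
    ((jacobiChar d n hn u : ℤˣ) : ℤ) = kroneckerSymbol d (residue u n) := by
  have h1 : residue u (4 * n) % d.natAbs = residue u n := by
    rw [← hn]; exact residue_mod u (by rw [PNat.mul_coe]; exact dvd_mul_left _ _)
  rw [jacobiChar_apply, ← h1, kroneckerSymbol_mod hd (odd_residue u n)]
  rw [h1]
  by_contra! H
  have := residue_coprime u n
  rw [H.2, Nat.coprime_zero_left, hn] at this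
  exact H.1 this

/-! ### The quadratic field -/

lemma IsRationalPower.exists_eq_add_mul (hρ : IsRationalPower r₀ ρ) (x : quadField ρ) :
    ∃ α β : ℚ, x = α + β *
      (⟨rpow ρ (1 / 2), IntermediateField.mem_adjoin_simple_self ℚ _⟩ : quadField ρ) := by
  have hx : (x : Qbar) ∈ Algebra.adjoin ℚ {(rpow ρ (1 / 2) : Qbar)} := by
    rw [← IntermediateField.adjoin_simple_toSubalgebra_of_isAlgebraic
      (Algebra.IsAlgebraic.isAlgebraic _)]
    exact x.2
  have key : ∀ y ∈ Algebra.adjoin ℚ {(rpow ρ (1 / 2) : Qbar)},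
      ∃ α β : ℚ, y = α + β * (rpow ρ (1 / 2) : Qbar) := by
    intro y hy
    induction hy using Algebra.adjoin_induction with
    | mem y hy =>
      rw [Set.mem_singleton_iff] at hy
      exact ⟨0, 1, by rw [hy]; simp⟩
    | algebraMap q => exact ⟨q, 0, by simp⟩
    | add y z _ _ hy hz =>
      obtain ⟨α, β, hy⟩ := hy
      obtain ⟨γ, δ, hz⟩ := hz
      exact ⟨α + γ, β + δ, by rw [hy, hz]; push_cast; ring⟩
    | mul y z _ _ hy hz =>
      obtain ⟨α, β, hy⟩ := hy
      obtain ⟨γ, δ, hz⟩ := hz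
      refine ⟨α * γ + β * δ * r₀, α * δ + β * γ, ?_⟩
      have := hρ.half_sq
      rw [eq_ratCast] at this
      rw [hy, hz]
      push_cast
      rw [← this]
      ring
  obtain ⟨α, β, h⟩ := key x hx
  refine ⟨α, β, Subtype.ext ?_⟩
  rw [h]
  push_cast
  rfl

lemma IsRationalPower.half_sq_quadField (hρ : IsRationalPower r₀ ρ) :
    (⟨rpow ρ (1 / 2), IntermediateField.mem_adjoin_simple_self ℚ _⟩ : quadField ρ) ^ 2
      = ((r₀ : ℚ) : quadField ρ) := by
  apply Subtype.ext
  have := hρ.half_sq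
  rw [eq_ratCast] at this
  push_cast
  exact this

lemma absDiscr_coe (ρ : Multiplicative ℚ →* Qbarˣ) :
    (absDiscr ρ : ℕ) = (NumberField.discr (quadField ρ)).natAbs := rfl

/-- The character `χ_K`, the Kronecker symbol of the discriminant composed with the cyclotomic
character. -/
def chiChar (r : ℚˣ) (ρ : Multiplicative ℚ →* Qbarˣ) : radicalAut r →* ℤˣ :=
  ((jacobiChar (NumberField.discr (quadField ρ)) (absDiscr ρ) (absDiscr_coe ρ)).comp
    (cycloChar r)).comp (radicalAut r).subtype

lemma cycloChar_affHomeo (hρ : IsRationalPower r₀ ρ) (h : IsRadicalGenerator r r₀) (x : TateModule)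
    (u : ZHatˣ) : cycloChar r (affHomeo hρ h ⟨x, u⟩) = u :=
  congrArg SemidirectProduct.right ((affEquiv hρ h).symm_apply_apply ⟨x, u⟩)

lemma chiChar_affHomeo_eq (hρ : IsRationalPower r₀ ρ) (h : IsRadicalGenerator r r₀)
    (x : TateModule) (u : ZHatˣ) : chiChar r ρ (affHomeo hρ h ⟨x, u⟩)
      = jacobiChar (NumberField.discr (quadField ρ)) (absDiscr ρ) (absDiscr_coe ρ) u :=
  congrArg (jacobiChar (NumberField.discr (quadField ρ)) (absDiscr ρ) (absDiscr_coe ρ))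
    (cycloChar_affHomeo hρ h x u)

lemma chiChar_affHomeo (hr : r ≠ 1) (hr' : r ≠ -1) (hρ : IsRationalPower r₀ ρ)
    (h : IsRadicalGenerator r r₀) (x : TateModule) (u : ZHatˣ) :
    ((chiChar r ρ (affHomeo hρ h ⟨x, u⟩) : ℤˣ) : ℤ)
      = kroneckerSymbol (NumberField.discr (quadField ρ)) (residue u (absDiscr ρ)) := by
  rw [chiChar_affHomeo_eq]
  exact jacobiChar_eq_kroneckerSymbol (discr_emod_four (finrank_eq_two hρ.half_sq_quadField
    (h.not_isSquare hr hr') hρ.exists_eq_add_mul)) _ _ _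

/-- Automorphisms of the algebraic closure act on `√r₀` through `χ_K` of their cyclotomic
character. -/
lemma map_half_eq_jacobiChar (hr : r ≠ 1) (hr' : r ≠ -1) (hρ : IsRationalPower r₀ ρ)
    (h : IsRadicalGenerator r r₀) {σ : Qbar ≃ₐ[ℚ] Qbar} {u : ZHatˣ}
    (hσ : ActsOnRoots σ (4 * absDiscr ρ : ℕ+) (residue u (4 * absDiscr ρ))) :
    σ (rpow ρ (1 / 2)) = (((jacobiChar (NumberField.discr (quadField ρ)) (absDiscr ρ)
      (absDiscr_coe ρ) u : ℤˣ) : ℤ) : Qbar) * (rpow ρ (1 / 2) : Qbar) := by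
  obtain ⟨q, hq⟩ := discr_eq_sq_mul hρ.half_sq_quadField (h.not_isSquare hr hr')
    hρ.exists_eq_add_mul
  have hd0 := NumberField.discr_ne_zero (quadField ρ)
  have hq0 : (q : Qbar) ≠ 0 := by
    intro h0
    have : q = 0 := by exact_mod_cast h0
    rw [this] at hq
    simp only [ne_eq, OfNat.ofNat_ne_zero, not_false_eq_true, zero_pow, zero_mul,
      Int.cast_eq_zero] at hq
    exact hd0 hq
  have hs : ((q : Qbar) * rpow ρ (1 / 2)) ^ 2
      = ((NumberField.discr (quadField ρ) : ℤ) : Qbar) := by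
    have h1 := hρ.half_sq
    rw [eq_ratCast] at h1
    rw [mul_pow, h1]
    have h2 : (((NumberField.discr (quadField ρ) : ℚ)) : Qbar) = ((q ^ 2 * r₀ : ℚ) : Qbar) := by
      rw [hq]
    push_cast at h2
    exact h2.symm
  have h3 := sqrtReciprocity hd0 σ _ (odd_residue u (absDiscr ρ)) hσ _ hs
  rw [map_mul, map_ratCast, mul_left_comm] at h3
  rw [jacobiChar_apply]
  exact mul_left_cancel₀ hq0 h3

end Characters

section Representation

variable {r r₀ : ℚˣ} {ρ : Multiplicative ℚ →* Qbarˣ}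

/-! ### The Galois group of the field of radicals -/

lemma unitAct_mem_radicals (σ : Qbar →ₐ[ℚ] Qbar) {x : Qbarˣ} (hx : x ∈ radicals r) :
    Units.map (σ : Qbar →* Qbar) x ∈ radicals r := by
  obtain ⟨k, hk, j, hj⟩ := hx
  refine ⟨k, hk, j, ?_⟩
  have hj' : ratUnits r ^ j = x ^ k := hj
  change ratUnits r ^ j = _
  rw [← map_pow, ← hj', map_zpow]
  congr 1
  exact Units.ext (σ.commutes r).symm

instance normal_radicalField : Normal ℚ (radicalField r) := by
  rw [IntermediateField.normal_iff_forall_map_le]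
  intro σ
  rw [radicalField, IntermediateField.adjoin_map, IntermediateField.adjoin_le_iff]
  rintro _ ⟨_, ⟨x, hx, rfl⟩, rfl⟩
  exact IntermediateField.subset_adjoin ℚ _ ⟨_, unitAct_mem_radicals σ hx, rfl⟩

instance isGalois_radicalField : IsGalois ℚ (radicalField r) :=
  { to_isSeparable := Algebra.IsAlgebraic.isSeparable_of_perfectField
    to_normal := normal_radicalField }

/-- The restriction of automorphisms of the algebraic closure to the field of radicals. -/
def resField (r : ℚˣ) : Gal(Qbar/ℚ) →* Gal(radicalField r/ℚ) :=
  AlgEquiv.restrictNormalHom (radicalField r)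

lemma resField_surjective : Function.Surjective (resField r) :=
  AlgEquiv.restrictNormalHom_surjective Qbar

lemma galoisRep_resField (σ : Gal(Qbar/ℚ)) (x : radicals r) :
    (((galoisRep r (resField r σ) : MulAut (radicals r)) x : radicals r) : Qbarˣ)
      = unitAct σ x :=
  Units.ext (AlgEquiv.restrictNormal_commutes σ (radicalField r) (toField r x : radicalField r))

lemma galoisRep_injective : Function.Injective (galoisRep r) := by
  intro f g hfg
  have hext : (f : radicalField r →ₐ[ℚ] radicalField r) = g := by
    refine IntermediateField.adjoin_algHom_ext ℚ fun x hx => ?_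
    obtain ⟨y, hy, rfl⟩ := hx
    have h1 : galAct r f ⟨y, hy⟩ = galAct r g ⟨y, hy⟩ :=
      congrArg (fun a : radicalAut r => (((a : MulAut (radicals r)) ⟨y, hy⟩ : radicals r) : Qbarˣ))
        hfg
    exact Subtype.ext (congrArg Units.val h1)
  ext1 x
  exact DFunLike.congr_fun hext x

lemma continuous_galoisRep : Continuous (galoisRep r) := by
  let _ : TopologicalSpace (radicals r) := ⊥
  have : DiscreteTopology (radicals r) := ⟨rfl⟩
  refine continuous_induced_rng.2 (continuous_pi fun y => continuous_discrete_rng.2 fun b => ?_)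
  rw [isOpen_iff_forall_mem_open]
  intro g hg
  have hopen := stabilizer_isOpen_of_isIntegral (K := ℚ) (toField r y : radicalField r)
  refine ⟨_, ?_, hopen.preimage (continuous_const_mul g⁻¹), ?_⟩
  · intro f hf
    have h1 : (g⁻¹ * f) (toField r y : radicalField r) = toField r y := hf
    have h2 : f (toField r y : radicalField r) = g (toField r y : radicalField r) := by
      conv_rhs => rw [← h1]
      rw [← AlgEquiv.mul_apply, mul_inv_cancel_left]
    change galAut r f y = b
    rw [← show galAut r g y = b from hg]
    exact Subtype.ext (Units.ext (congrArg Subtype.val h2))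
  · change (g⁻¹ * g) (toField r y : radicalField r) = toField r y
    rw [inv_mul_cancel]; rfl

instance t2Space_radicalAut : T2Space (radicalAut r) := by
  refine ⟨fun a b hab => ?_⟩
  obtain ⟨y, hy⟩ : ∃ y, (a : MulAut (radicals r)) y ≠ (b : MulAut (radicals r)) y := by
    by_contra! H
    exact hab (Subtype.ext (MulEquiv.ext H))
  refine ⟨_, _, isOpen_apply_mem y {(a : MulAut (radicals r)) y},
    isOpen_apply_mem y {(b : MulAut (radicals r)) y}, rfl, rfl, ?_⟩
  rw [Set.disjoint_left]
  exact fun c hc hc' => hy (Eq.trans (Eq.symm hc) hc')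

lemma actsOnRoots_of_galoisRep (σ : Gal(Qbar/ℚ)) (n : ℕ+) :
    ActsOnRoots σ n (residue (cycloChar r (galoisRep r (resField r σ))) n) := by
  intro z hz
  have hz0 : z ≠ 0 := by
    rintro rfl
    rw [zero_pow n.ne_zero] at hz
    exact zero_ne_one hz
  have hu : (Units.mk0 z hz0) ^ (n : ℕ) = 1 := Units.ext (by simpa using hz)
  let y : radicals r := ⟨Units.mk0 z hz0, mem_radicals_of_pow_eq_one n.ne_zero hu⟩
  have h1 := apply_torsion (galoisRep r (resField r σ) : MulAut (radicals r)) (z := y) (n := n)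
    (Subtype.ext hu)
  have h2 := galoisRep_resField σ y
  rw [h1] at h2
  exact (congrArg Units.val h2).symm

lemma int_units_mul_eq_one_iff (a b : ℤˣ) : a * b = 1 ↔ a = b := by
  rw [mul_eq_one_iff_eq_inv, Int.units_inv_eq_self]

lemma range_galoisRep_le (hr : r ≠ 1) (hr' : r ≠ -1) (hρ : IsRationalPower r₀ ρ)
    (h : IsRadicalGenerator r r₀) :
    (galoisRep r).range ≤ (psiChar hρ h * chiChar r ρ).ker := by
  rintro _ ⟨g, rfl⟩
  obtain ⟨σ, rfl⟩ := resField_surjective g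
  rw [MonoidHom.mem_ker, MonoidHom.mul_apply, int_units_mul_eq_one_iff]
  apply intUnits_eq_of_cast_mul (y := rpow ρ (1 / 2))
  let w : radicals r := ⟨_, hρ.rpow_mem h (1 / 2)⟩
  rw [← psiChar_spec hρ h _ w rfl, galoisRep_resField]
  exact map_half_eq_jacobiChar hr hr' hρ h (actsOnRoots_of_galoisRep (r := r) σ _)

/-- Surjectivity at the finite level `M`: correct an automorphism with the right action on the
`M`-th roots of unity by one that fixes these. -/
lemma exists_galois_of_mem_ker (hr : r ≠ 1) (hr' : r ≠ -1) (hρ : IsRationalPower r₀ ρ)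
    (h : IsRadicalGenerator r r₀) {a : radicalAut r}
    (ha : a ∈ (psiChar hρ h * chiChar r ρ).ker) {M : ℕ+}
    (hM : ((4 * absDiscr ρ : ℕ+) : ℕ) ∣ M) :
    ∃ σ : Gal(Qbar/ℚ), (∀ z : radicals r, z ^ (M : ℕ) = 1 →
        unitAct σ z = ((a : MulAut (radicals r)) z : radicals r)) ∧
      ∀ y : radicals r, (y : Qbarˣ) = rpow ρ (1 / (M : ℚ)) →
        unitAct σ y = ((a : MulAut (radicals r)) y : radicals r) := by
  rw [MonoidHom.mem_ker, MonoidHom.mul_apply, int_units_mul_eq_one_iff] at ha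
  set u := cycloChar r a with hu
  obtain ⟨σ₀, hσ₀⟩ := exists_actsOnRoots M.ne_zero (residue_coprime u M)
  obtain ⟨L, hL⟩ : ∃ L, (M : ℕ) = 2 * L := by
    rw [PNat.mul_coe] at hM
    exact (dvd_trans (by norm_num : 2 ∣ ((4 : ℕ+) : ℕ)) (dvd_of_mul_right_dvd hM))
  have hσd : ActsOnRoots σ₀ (4 * absDiscr ρ : ℕ+) (residue u (4 * absDiscr ρ)) := by
    intro z hz
    have hzM : z ^ (M : ℕ) = 1 := by
      obtain ⟨c, hc⟩ := hM
      rw [hc, pow_mul, hz, one_pow]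
    rw [hσ₀ z hzM, ← residue_mod u hM, ← pow_eq_pow_mod _ hz]
  set α : radicals r := ⟨_, hρ.rpow_mem h (1 / (M : ℚ))⟩ with hα
  let w : radicals r := ⟨_, hρ.rpow_mem h (1 / 2)⟩
  have hαw : α ^ L = w := by
    apply Subtype.ext
    change rpow ρ _ ^ L = rpow ρ _
    rw [← rpow_mul_nat]
    congr 1
    have hL0 : (L : ℚ) ≠ 0 := by
      have := M.ne_zero
      have : L ≠ 0 := by rintro rfl; omega
      exact_mod_cast this
    have hMq : ((M : ℕ) : ℚ) = 2 * L := by exact_mod_cast hL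
    rw [hMq]; field_simp
  -- both `a` and `σ₀` act on `√r₀` through `χ_K`
  have hw : unitAct σ₀ w = ((a : MulAut (radicals r)) w : radicals r) := by
    apply Units.ext
    rw [psiChar_spec hρ h a w rfl, ha]
    exact map_half_eq_jacobiChar hr hr' hρ h hσd
  set v : Qbarˣ := unitAct σ₀⁻¹ ((a : MulAut (radicals r)) α : radicals r) * (α : Qbarˣ)⁻¹ with hv
  have hvL : v ^ L = 1 := by
    rw [hv, mul_pow, ← map_pow, inv_pow, ← Subgroup.coe_pow, ← map_pow, ← Subgroup.coe_pow, hαw,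
      ← hw, unitAct_inv_apply, mul_inv_cancel]
  obtain ⟨-, τ, hτ, hτα⟩ := mem_kummerGroup hρ h hL hvL
  refine ⟨σ₀ * τ, fun z hz => ?_, fun y hy => ?_⟩
  · have hz' : (z : Qbarˣ) ^ (M : ℕ) = 1 := congrArg Subtype.val hz
    rw [unitAct_mul, hτ.unit hz', pow_one, hσ₀.unit hz', apply_torsion _ hz]
    rfl
  · have : y = α := Subtype.ext hy
    rw [this, unitAct_mul]
    have h2 : unitAct τ α = v * α := hτα
    rw [h2, hv, inv_mul_cancel_right, unitAct_apply_inv]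

/-- Compactness of the Galois group turns surjectivity at all finite levels into surjectivity. -/
lemma ker_le_range_galoisRep (hr : r ≠ 1) (hr' : r ≠ -1) (hρ : IsRationalPower r₀ ρ)
    (h : IsRadicalGenerator r r₀) :
    (psiChar hρ h * chiChar r ρ).ker ≤ (galoisRep r).range := by
  intro a ha
  let S : ℕ+ → Set Gal(radicalField r/ℚ) := fun N =>
    {g | (∀ z : radicals r, z ^ (N : ℕ) = 1 →
        (galoisRep r g : MulAut (radicals r)) z = (a : MulAut (radicals r)) z) ∧
      ∀ y : radicals r, (y : Qbarˣ) = rpow ρ (1 / (N : ℚ)) →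
        (galoisRep r g : MulAut (radicals r)) y = (a : MulAut (radicals r)) y}
  have hmono : ∀ M N : ℕ+, S (M * N) ⊆ S N := by
    rintro M N g ⟨hg1, hg2⟩
    refine ⟨fun z hz => hg1 z (by rw [PNat.mul_coe, mul_comm, pow_mul, hz, one_pow]),
      fun y hy => ?_⟩
    let w : radicals r := ⟨_, hρ.rpow_mem h (1 / ((M * N : ℕ+) : ℚ))⟩
    have hM0 : ((M : ℕ) : ℚ) ≠ 0 := by exact_mod_cast M.ne_zero
    have hw : y = w ^ (M : ℕ) := by
      apply Subtype.ext
      rw [hy]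
      change _ = rpow ρ _ ^ (M : ℕ)
      rw [← rpow_mul_nat]
      congr 1; push_cast; field_simp
    rw [hw, map_pow, map_pow, hg2 w rfl]
  have hne : ∀ N, (S N).Nonempty := by
    intro N
    obtain ⟨σ, hσ1, hσ2⟩ := exists_galois_of_mem_ker hr hr' hρ h ha
      (M := 4 * absDiscr ρ * N) (by rw [PNat.mul_coe _ N]; exact dvd_mul_right _ _)
    refine ⟨resField r σ, hmono (4 * absDiscr ρ) N ⟨fun z hz => ?_, fun y hy => ?_⟩⟩
    · exact Subtype.ext ((galoisRep_resField σ z).trans (hσ1 z hz))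
    · exact Subtype.ext ((galoisRep_resField σ y).trans (hσ2 y hy))
  have hclosed : ∀ N, IsClosed (S N) := by
    intro N
    have hc : ∀ y : radicals r, IsClosed {g : Gal(radicalField r/ℚ) |
        (galoisRep r g : MulAut (radicals r)) y = (a : MulAut (radicals r)) y} := by
      intro y
      rw [← isOpen_compl_iff]
      exact (isOpen_apply_mem y {(a : MulAut (radicals r)) y}ᶜ).preimage continuous_galoisRep
    have hS : S N = (⋂ (z : radicals r) (_ : z ^ (N : ℕ) = 1), {g : Gal(radicalField r/ℚ) |
          (galoisRep r g : MulAut (radicals r)) z = (a : MulAut (radicals r)) z}) ∩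
        ⋂ (y : radicals r) (_ : (y : Qbarˣ) = rpow ρ (1 / (N : ℚ))),
          {g : Gal(radicalField r/ℚ) |
            (galoisRep r g : MulAut (radicals r)) y = (a : MulAut (radicals r)) y} := by
      ext g; simp [S]
    rw [hS]
    exact (isClosed_iInter fun z => isClosed_iInter fun _ => hc z).inter
      (isClosed_iInter fun y => isClosed_iInter fun _ => hc y)
  obtain ⟨g, hg⟩ := IsCompact.nonempty_iInter_of_directed_nonempty_isCompact_isClosed S
    (fun M N => ⟨M * N, by rw [mul_comm]; exact hmono N M, hmono M N⟩) hne
    (fun N => (hclosed N).isCompact) hclosed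
  rw [Set.mem_iInter] at hg
  refine ⟨g, Subtype.ext ?_⟩
  have hhom : ((galoisRep r g : MulAut (radicals r)) : radicals r →* radicals r)
      = ((a : MulAut (radicals r)) : radicals r →* radicals r) :=
    radicals_hom_ext hρ h (fun z n hz => (hg n).1 z hz) (fun y n hy => (hg n).2 y hy)
  ext1 y
  exact DFunLike.congr_fun hhom y

lemma range_galoisRep (hr : r ≠ 1) (hr' : r ≠ -1) (hρ : IsRationalPower r₀ ρ)
    (h : IsRadicalGenerator r r₀) :
    (galoisRep r).range = (psiChar hρ h * chiChar r ρ).ker :=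
  le_antisymm (range_galoisRep_le hr hr' hρ h) (ker_le_range_galoisRep hr hr' hρ h)

lemma isOpen_ker (hρ : IsRationalPower r₀ ρ) (h : IsRadicalGenerator r r₀) :
    IsOpen ((psiChar hρ h * chiChar r ρ).ker : Set (radicalAut r)) := by
  have h1 : Continuous (psiChar hρ h) := by
    refine continuous_of_apply _ ⟨_, hρ.rpow_mem h (1 / 2)⟩ fun a b hab => ?_
    apply intUnits_eq_of_cast_mul (y := rpow ρ (1 / 2))
    have ha := psiChar_spec hρ h a ⟨_, hρ.rpow_mem h (1 / 2)⟩ rfl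
    rw [hab] at ha
    exact ha.symm.trans (psiChar_spec hρ h b ⟨_, hρ.rpow_mem h (1 / 2)⟩ rfl)
  have h2 : Continuous (chiChar r ρ) := by
    refine continuous_of_apply _ (zetaRad r (4 * absDiscr ρ)) fun a b hab => ?_
    apply Units.ext
    change jacobiSym _ (residue (cycloChar r a) _) = jacobiSym _ (residue (cycloChar r b) _)
    congr 1
    obtain ⟨k, hk⟩ := exists_exponent (a : MulAut (radicals r)) (4 * absDiscr ρ)
    exact congrArg ZMod.val ((cycloMod_eq hk).trans (cycloMod_eq (hab ▸ hk)).symm)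
  exact (isOpen_discrete {p : ℤˣ × ℤˣ | p.1 * p.2 = 1}).preimage (h1.prodMk h2)

lemma isOpenEmbedding_galoisRep (hr : r ≠ 1) (hr' : r ≠ -1) (hρ : IsRationalPower r₀ ρ)
    (h : IsRadicalGenerator r r₀) : Topology.IsOpenEmbedding (galoisRep r) := by
  refine ⟨(continuous_galoisRep.isClosedEmbedding galoisRep_injective).isEmbedding, ?_⟩
  rw [← MonoidHom.coe_range, range_galoisRep hr hr' hρ h]
  exact isOpen_ker hρ h

/-- There is a compatible system of roots of unity starting with `-1`. -/
lemma exists_tate_component_two : ∃ x : TateModule, component x 2 = -1 := by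
  obtain ⟨f, hf⟩ := exists_ratHom (-1)
  have hf1 : rpow f 1 = -1 := hf
  refine ⟨⟨fun n => ⟨rpow f (2 / (n : ℚ)), ?_⟩, ?_⟩, ?_⟩
  · have hn : ((n : ℕ) : ℚ) ≠ 0 := by exact_mod_cast n.ne_zero
    rw [mem_rootsOfUnity, ← rpow_mul_nat, div_mul_cancel₀ _ hn]
    have := rpow_mul_nat (ρ := f) 1 2
    rw [one_mul, hf1] at this
    simpa using this
  · intro m n
    have hm : ((m : ℕ) : ℚ) ≠ 0 := by exact_mod_cast m.ne_zero
    change rpow f _ ^ (m : ℕ) = rpow f _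
    rw [← rpow_mul_nat]
    congr 1; push_cast; field_simp
  · change rpow f (2 / ((2 : ℕ+) : ℕ)) = -1
    rw [← hf1]
    congr 1
    norm_num

lemma index_range_galoisRep (hr : r ≠ 1) (hr' : r ≠ -1) (hρ : IsRationalPower r₀ ρ)
    (h : IsRadicalGenerator r r₀) : (galoisRep r).range.index = 2 := by
  obtain ⟨x, hx⟩ := exists_tate_component_two
  rw [range_galoisRep hr hr' hρ h, Subgroup.index_ker]
  have h1 : psiChar hρ h (affHomeo hρ h ⟨x, 1⟩) = -1 := by
    have := psiChar_affHomeo hρ h x 1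
    rw [hx, Units.val_neg, Units.val_one] at this
    have h' : ((psiChar hρ h (affHomeo hρ h ⟨x, 1⟩) : ℤˣ) : ℤ) = ((-1 : ℤ) : ℤ) := by
      apply Int.cast_injective (α := Qbar)
      rw [this, Int.cast_neg, Int.cast_one]
    exact Units.ext h'
  have h2 : chiChar r ρ (affHomeo hρ h ⟨x, 1⟩) = 1 := by
    rw [chiChar_affHomeo_eq, map_one]
  have htop : (psiChar hρ h * chiChar r ρ).range = ⊤ := by
    rw [eq_top_iff]
    intro ε _
    rcases Int.units_eq_one_or ε with rfl | rfl
    · exact one_mem _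
    · exact ⟨_, by rw [MonoidHom.mul_apply, h1, h2, mul_one]⟩
  rw [htop, Subgroup.card_top, Nat.card_eq_fintype_card]
  rfl

end Representation

end RadicalGalois

end

open RadicalGalois in
theorem theorem2p7 (r : ℚˣ) (hr : r ≠ 1) (hr' : r ≠ -1) :
    (∃ r₀ : ℚˣ, IsRadicalGenerator r r₀) ∧
    ∀ r₀ : ℚˣ, IsRadicalGenerator r r₀ →
      (∃ ρ : Multiplicative ℚ →* Qbarˣ, IsRationalPower r₀ ρ) ∧
      ∀ ρ : Multiplicative ℚ →* Qbarˣ, IsRationalPower r₀ ρ →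
        -- the only rational powers of `r₀` in `ℚ_ab` are the powers of `r₀ ^ (1/2)`
        ρ.range ⊓ QabUnits = Subgroup.zpowers (rpow ρ (1 / 2)) ∧
        -- `A ≅ μ̂ ⋊ Ẑ*` as topological groups
        ∃ Φ : AffineGroup ≃ₜ* radicalAut r,
          (∀ (x : TateModule) (u : ZHatˣ) (n : ℕ+) (y : radicals r),
            (y : Qbarˣ) = rpow ρ (1 / (n : ℚ)) →
              (((Φ ⟨x, u⟩ : MulAut (radicals r)) y : radicals r) : Qbarˣ)
                = component x n * y) ∧
          (∀ (x : TateModule) (u : ZHatˣ) (n : ℕ+) (z : radicals r), z ^ (n : ℕ) = 1 →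
              (Φ ⟨x, u⟩ : MulAut (radicals r)) z = z ^ residue u n) ∧
          -- the characters `ψ_K` and `χ_K`, and the description of `G` as a subgroup of `A`
          ∃ ψ χ : radicalAut r →* ℤˣ,
            (∀ (x : TateModule) (u : ZHatˣ),
              (((ψ (Φ ⟨x, u⟩) : ℤˣ) : ℤ) : Qbar) = (component x 2 : Qbar)) ∧
            (∀ (a : radicalAut r) (y : radicals r), (y : Qbarˣ) = rpow ρ (1 / 2) →
              ((((a : MulAut (radicals r)) y : radicals r) : Qbarˣ) : Qbar)
                = ((ψ a : ℤ) : Qbar) * ((y : Qbarˣ) : Qbar)) ∧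
            (∀ (x : TateModule) (u : ZHatˣ),
              ((χ (Φ ⟨x, u⟩) : ℤˣ) : ℤ)
                = kroneckerSymbol (NumberField.discr (quadField ρ)) (residue u (absDiscr ρ))) ∧
            Topology.IsOpenEmbedding (galoisRep r) ∧
            (galoisRep r).range = (ψ * χ).ker ∧
            (galoisRep r).range.index = 2 := by
  refine ⟨exists_isRadicalGenerator hr hr', fun r₀ h => ⟨?_, fun ρ hρ =>
    ⟨hρ.range_inf_QabUnits h, affHomeo hρ h, affHomeo_root hρ h, affHomeo_torsion hρ h,
      psiChar hρ h, chiChar r ρ, psiChar_affHomeo hρ h, psiChar_spec hρ h,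
      chiChar_affHomeo hr hr' hρ h, isOpenEmbedding_galoisRep hr hr' hρ h,
      range_galoisRep hr hr' hρ h, index_range_galoisRep hr hr' hρ h⟩⟩⟩
  exact exists_isRationalPower h hr hr'
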